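/- A Jordan algebra over $\mathbb{R}$ is a real vector space $J$ with a symmetric bilinear product $\circ$ such that $x^{2}\circ(x\circ y)=x\circ(x^{2}\circ y)$ for all $x,y\in J$, where $x^2=x\circ x$. It is nilpotent if its lower central series $c^{1}(J)=J$, $c^{m+1}(J)=c^{m}(J)\circ J$ (the linear span of the products) reaches $0$. A central component of $J$ is a nonzero ideal $I$ with $I\circ J=0$ such that $J=K\oplus I$ for some ideal $K$ of $J$. Consider the following algebras with basis $a,b,c,d$ and commutative bilinear product, where $\alpha\in\{1,-1\}$ and products of basis elements that are not determined by the listed ones and commutativity are zero: - $J_{4,1}$: all products are zero; - $J_{4,2}$: $a^2=b$; - $J_{4,3}^{\alpha}$: $a^2=c$, $b^2=\alpha c$; - $J_{4,4}$: $a^2=b$, $a\circ b=c$; - $J_{4,5}^{\alpha}$: $a^2=d$, $b^2=d$, $c^2=\alpha d$; - $J_{4,6}$: $a^2=b$, $b\circ c=d$; - $J_{4,7}$: $a^2=b$, $a\circ b=d$, $c^2=d$; - $J_{4,8}^{\alpha}$: $a^2=c$, $b^2=\alpha c$, $a\circ c=d$; - $J_{4,9}$: $a^2=c$, $b^2=-c$,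 $a\circ c=d$, $b\circ c=d$; - $J_{4,10}$: $a^2=c$, $b^2=-c$, $a\circ c=d$, $b\circ c=d$, $a\circ b=d$; - $J_{4,11}$: $a^2=b$, $a\circ b=c$, $a\circ c=d$, $b^2=d$; - $J_{4,12}$: $a^2=c$, $a\circ b=d$; - $J_{4,13}^{\alpha}$: $a^2=c$, $b^2=\alpha c$, $a\circ b=d$. Theorem. These are $17$ pairwise non-isomorphic nilpotent Jordan algebras of dimension $4$ over $\mathbb{R}$, and every nilpotent Jordan algebra of dimension $4$ over $\mathbb{R}$ is isomorphic to one of them. So up to isomorphism there are exactly $17$ nilpotent Jordan algebras of dimension $4$ over $\mathbb{R}$. The algebras $J_{4,1}$, $J_{4,2}$, $J_{4,3}^{\pm1}$, $J_{4,4}$ have a central component and the other twelve have none. More precisely, let $J_{1,1}$ be the one-dimensional algebra with zero product, and let $J_{3,1}$, $J_{3,2}$, $J_{3,3}^{\alpha}$, $J_{3,4}$ be the three-dimensional algebras with basis $a,b,c$ and, respectively, zero product; $a^2=b$; $a^2=c$, $b^2=\alpha c$; $a^2=b$, $a\circ b=c$. Then $J_{4,1}\cong J_{3,1}\oplus J_{1,1}$,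 $J_{4,2}\cong J_{3,2}\oplus J_{1,1}$, $J_{4,3}^{\alpha}\cong J_{3,3}^{\alpha}\oplus J_{1,1}$ for $\alpha=\pm1$, and $J_{4,4}\cong J_{3,4}\oplus J_{1,1}$. All $17$ algebras are associative except $J_{4,6}$, $J_{4,8}^{1}$, $J_{4,8}^{-1}$, $J_{4,9}$ and $J_{4,10}$, which are not associative. -/

import Mathlib

universe u

namespace RealNilpotentJordan

/-- The `i`-th basis vector of `ℝⁿ`. -/
noncomputable def e {n : ℕ} (i : Fin n) : Fin n → ℝ := Pi.single i 1

/-- The real algebra with basis `e 0, …, e (n - 1)` (the underlying vector space is `ℝⁿ`) and the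
commutative bilinear product determined by `e i * e j = T i j` for `i ≤ j`.
The entries `T i j` with `i > j` are not used. -/
def TableAlgebra {n : ℕ} (_T : Fin n → Fin n → (Fin n → ℝ)) : Type := Fin n → ℝ

namespace TableAlgebra

variable {n : ℕ} (T : Fin n → Fin n → (Fin n → ℝ))

noncomputable instance : AddCommGroup (TableAlgebra T) := inferInstanceAs (AddCommGroup (Fin n → ℝ))

noncomputable instance : Module ℝ (TableAlgebra T) := inferInstanceAs (Module ℝ (Fin n → ℝ))

/-- The product `x * y = ∑ i j, x i • y j • (e i * e j)`. -/
noncomputable instance : Mul (TableAlgebra T) :=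
  ⟨fun x y => (fun k => ∑ i, ∑ j, x i * y j * T (min i j) (max i j) k : Fin n → ℝ)⟩

theorem mul_apply (x y : TableAlgebra T) (k : Fin n) :
    (x * y : TableAlgebra T) k = ∑ i, ∑ j, x i * y j * T (min i j) (max i j) k := rfl

theorem add_apply (x y : TableAlgebra T) (k : Fin n) : (x + y) k = x k + y k := rfl

theorem zero_apply (k : Fin n) : (0 : TableAlgebra T) k = 0 := rfl

theorem smul_apply (r : ℝ) (x : TableAlgebra T) (k : Fin n) : (r • x) k = r * x k := rfl

theorem ext' {x y : TableAlgebra T} (h : ∀ k, x k = y k) : x = y := funext h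

/-- The product of basis vectors is given by the table. -/
theorem basis_mul (i j : Fin n) :
    (show TableAlgebra T from e i) * (show TableAlgebra T from e j)
      = (show TableAlgebra T from T (min i j) (max i j)) := ext' T fun k => by
  have h : ∑ i', ∑ j', e i i' * e j j' * T (min i' j') (max i' j') k
      = T (min i j) (max i j) k := by
    simp [e, Pi.single_apply]
  exact h

noncomputable instance : NonUnitalNonAssocCommRing (TableAlgebra T) where
  left_distrib x y z := ext' T fun k => by
    simp only [mul_apply, add_apply, ← Finset.sum_add_distrib]
    exact Finset.sum_congr rfl fun i _ => Finset.sum_congr rfl fun j _ => by ring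
  right_distrib x y z := ext' T fun k => by
    simp only [mul_apply, add_apply, ← Finset.sum_add_distrib]
    exact Finset.sum_congr rfl fun i _ => Finset.sum_congr rfl fun j _ => by ring
  zero_mul x := ext' T fun k => by simp [mul_apply, zero_apply]
  mul_zero x := ext' T fun k => by simp [mul_apply, zero_apply]
  mul_comm x y := ext' T fun k => by
    simp only [mul_apply]
    rw [Finset.sum_comm]
    exact Finset.sum_congr rfl fun i _ => Finset.sum_congr rfl fun j _ => by
      rw [min_comm, max_comm]; ring

instance : IsScalarTower ℝ (TableAlgebra T) (TableAlgebra T) :=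
  ⟨fun r x y => ext' T fun k => by
    simp only [smul_eq_mul, mul_apply, smul_apply, Finset.mul_sum]
    exact Finset.sum_congr rfl fun i _ => Finset.sum_congr rfl fun j _ => by ring⟩

instance : SMulCommClass ℝ (TableAlgebra T) (TableAlgebra T) :=
  ⟨fun r x y => ext' T fun k => by
    simp only [smul_eq_mul, mul_apply, smul_apply, Finset.mul_sum]
    exact Finset.sum_congr rfl fun i _ => Finset.sum_congr rfl fun j _ => by ring⟩

end TableAlgebra

/-- Isomorphism of (not necessarily associative or unital) real algebras. -/
def AlgIso (A B : Type*) [NonUnitalNonAssocRing A] [Module ℝ A]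
    [NonUnitalNonAssocRing B] [Module ℝ B] : Prop :=
  ∃ e : A ≃ₗ[ℝ] B, ∀ x y : A, e (x * y) = e x * e y

/-- The lower central series: `lcs 0 = A`, and `lcs (m + 1)` is the span of the products `x * y`
with `x ∈ lcs m` and `y ∈ A`. -/
noncomputable def lowerCentralSeries (A : Type*) [NonUnitalNonAssocCommRing A] [Module ℝ A]
    [IsScalarTower ℝ A A] [SMulCommClass ℝ A A] : ℕ → Submodule ℝ A
  | 0 => ⊤
  | m + 1 => Submodule.map₂ (LinearMap.mul ℝ A) (lowerCentralSeries A m) ⊤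

/-- An algebra is nilpotent if its lower central series reaches zero. -/
def IsNilpotentAlgebra (A : Type*) [NonUnitalNonAssocCommRing A] [Module ℝ A]
    [IsScalarTower ℝ A A] [SMulCommClass ℝ A A] : Prop :=
  ∃ m : ℕ, lowerCentralSeries A m = ⊥

/-- `A` has a (nonzero) central component: a nonzero ideal `I` with `I A = 0` that is a direct
summand, i.e. `A = K ⊕ I` for some ideal `K`. (As `A` is commutative, ideals are two-sided.) -/
def HasCentralComponent (A : Type*) [NonUnitalNonAssocCommRing A] [Module ℝ A] : Prop :=
  ∃ K I : Submodule ℝ A, IsCompl K I ∧ I ≠ ⊥ ∧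
    (∀ x ∈ K, ∀ y : A, x * y ∈ K) ∧ (∀ x ∈ I, ∀ y : A, x * y = 0)

/-- The real number `1` or `-1` named by a sign. -/
noncomputable def sgn (α : ℤˣ) : ℝ := ((α : ℤ) : ℝ)

/-! In the tables below the basis `a, b, c, d` is `e 0, e 1, e 2, e 3`. -/

/-- `J_{1,1}`: the one-dimensional algebra with zero product. -/
abbrev J11 : Type := TableAlgebra (n := 1) fun _ _ => 0

/-- `J_{3,1}`: zero product. -/
abbrev J31 : Type := TableAlgebra (n := 3) fun _ _ => 0

/-- `J_{3,2}`: `a² = b`. -/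
abbrev J32 : Type := TableAlgebra (n := 3) fun
  | 0, 0 => e 1
  | _, _ => 0

/-- `J_{3,3}^α`: `a² = c`, `b² = α c`. -/
abbrev J33 (α : ℤˣ) : Type := TableAlgebra (n := 3) fun
  | 0, 0 => e 2
  | 1, 1 => sgn α • e 2
  | _, _ => 0

/-- `J_{3,4}`: `a² = b`, `a b = c`. -/
abbrev J34 : Type := TableAlgebra (n := 3) fun
  | 0, 0 => e 1
  | 0, 1 => e 2
  | _, _ => 0

/-- The labels of the list of four-dimensional algebras; `α : ℤˣ` is the sign `±1`. -/
inductive Label : Type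
  | j1
  | j2
  | j3 (α : ℤˣ)
  | j4
  | j5 (α : ℤˣ)
  | j6
  | j7
  | j8 (α : ℤˣ)
  | j9
  | j10
  | j11
  | j12
  | j13 (α : ℤˣ)

/-- The multiplication tables of the list. -/
noncomputable def table : Label → Fin 4 → Fin 4 → (Fin 4 → ℝ)
  -- all products are zero
  | .j1 => fun _ _ => 0
  -- `a² = b`
  | .j2 => fun
    | 0, 0 => e 1
    | _, _ => 0
  -- `a² = c`, `b² = α c`
  | .j3 α => fun
    | 0, 0 => e 2
    | 1, 1 => sgn α • e 2
    | _, _ => 0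
  -- `a² = b`, `a b = c`
  | .j4 => fun
    | 0, 0 => e 1
    | 0, 1 => e 2
    | _, _ => 0
  -- `a² = d`, `b² = d`, `c² = α d`
  | .j5 α => fun
    | 0, 0 => e 3
    | 1, 1 => e 3
    | 2, 2 => sgn α • e 3
    | _, _ => 0
  -- `a² = b`, `b c = d`
  | .j6 => fun
    | 0, 0 => e 1
    | 1, 2 => e 3
    | _, _ => 0
  -- `a² = b`, `a b = d`, `c² = d`
  | .j7 => fun
    | 0, 0 => e 1
    | 0, 1 => e 3
    | 2, 2 => e 3
    | _, _ => 0
  -- `a² = c`, `b² = α c`, `a c = d`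
  | .j8 α => fun
    | 0, 0 => e 2
    | 1, 1 => sgn α • e 2
    | 0, 2 => e 3
    | _, _ => 0
  -- `a² = c`, `b² = -c`, `a c = d`, `b c = d`
  | .j9 => fun
    | 0, 0 => e 2
    | 1, 1 => -e 2
    | 0, 2 => e 3
    | 1, 2 => e 3
    | _, _ => 0
  -- `a² = c`, `b² = -c`, `a c = d`, `b c = d`, `a b = d`
  | .j10 => fun
    | 0, 0 => e 2
    | 1, 1 => -e 2
    | 0, 2 => e 3
    | 1, 2 => e 3
    | 0, 1 => e 3
    | _, _ => 0
  -- `a² = b`, `a b = c`, `a c = d`, `b² = d`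
  | .j11 => fun
    | 0, 0 => e 1
    | 0, 1 => e 2
    | 0, 2 => e 3
    | 1, 1 => e 3
    | _, _ => 0
  -- `a² = c`, `a b = d`
  | .j12 => fun
    | 0, 0 => e 2
    | 0, 1 => e 3
    | _, _ => 0
  -- `a² = c`, `b² = α c`, `a b = d`
  | .j13 α => fun
    | 0, 0 => e 2
    | 1, 1 => sgn α • e 2
    | 0, 1 => e 3
    | _, _ => 0

/-- The four-dimensional algebra `J_{4,k}` (or `J_{4,k}^α`) with the given label. -/
abbrev J4 (l : Label) : Type := TableAlgebra (table l)

/-- The labels listed under the heading "with central component". -/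
def Label.withCentralComponent : Set Label :=
  {l | l = .j1 ∨ l = .j2 ∨ (∃ α, l = .j3 α) ∨ l = .j4}

/-- The labels of the non-associative algebras of the list. -/
def Label.nonassociative : Set Label :=
  {l | l = .j6 ∨ (∃ α, l = .j8 α) ∨ l = .j9 ∨ l = .j10}

end RealNilpotentJordan

namespace RealNilpotentJordan

/-! Write Aᵐ⁺¹ for `lowerCentralSeries A m`. In a nilpotent algebra of dimension 4 the dimensions of
these ideals drop strictly until they reach zero (`finrank_lowerCentralSeries_succ_lt`), so only a
few cases occur.

If A² = 0 the product is zero. If A² is a line and A³ = 0, the product is a quadratic form on a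
complement of A². Sylvester's theorem, together with the freedom to change the sign of the generator
of A², gives the diagonal models (`exists_algIso_of_finrank_one`). If dim A² = 2 and A³ = 0, the
products u², uv, v² of two generators satisfy a linear relation; completing the square turns it into
u² = s v², and only the sign of s matters (`exists_algIso_of_finrank_two_of_eq_bot`). If dim A² = 3,
a single element generates A, and the Jordan identity determines the whole table
(`exists_algIso_of_finrank_three`).

The main case is dim A² = 2, dim A³ = 1, A⁴ = 0. Here some square c spans A² modulo A³, the Jordan
identity gives c² = 0, and multiplication by c singles out a line of generators that it kills. This
is an `IsAdapted` family. Modulo A³ the product is a binary quadratic form with a distinguished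
line, and `IsAdapted.exists_algIso` reduces it to normal form.

For the other half, the tables are explicit, so the identities are checked in coordinates through
`vec_mul`. Non-isomorphism uses properties stated only through products, zero and scalars, which
every isomorphism carries over (`AlgIso.invariants`). One of them, that every annihilating element
is a product, also excludes central components (`not_hasCentralComponent`). -/

theorem Label.forall_iff {P : Label → Prop} :
    (∀ l, P l) ↔ P .j1 ∧ P .j2 ∧ P (.j3 1) ∧ P (.j3 (-1)) ∧ P .j4 ∧ P (.j5 1) ∧ P (.j5 (-1)) ∧
      P .j6 ∧ P .j7 ∧ P (.j8 1) ∧ P (.j8 (-1)) ∧ P .j9 ∧ P .j10 ∧ P .j11 ∧ P .j12 ∧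
      P (.j13 1) ∧ P (.j13 (-1)) := by
  constructor
  · intro h
    simp only [h, and_self]
  · rintro ⟨h1, h2, h3, h3', h4, h5, h5', h6, h7, h8, h8', h9, h10, h11, h12, h13, h13'⟩ l
    rcases l with _ | _ | α | _ | α | _ | _ | α | _ | _ | _ | _ | α
    all_goals first | assumption | (rcases Int.units_eq_one_or α with rfl | rfl <;> assumption)

/-! ### Multiplication of the listed algebras in coordinates. -/

@[simp] theorem sgn_one : sgn 1 = 1 := by simp [sgn]

@[simp] theorem sgn_neg_one : sgn (-1) = -1 := by simp [sgn]

/-- The product of two vectors of `ℝ⁴` in the algebra with the given label. -/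
noncomputable def prod4 : Label → (Fin 4 → ℝ) → (Fin 4 → ℝ) → Fin 4 → ℝ
  | .j1, _, _ => ![0, 0, 0, 0]
  | .j2, x, y => ![0, x 0 * y 0, 0, 0]
  | .j3 α, x, y => ![0, 0, x 0 * y 0 + sgn α * (x 1 * y 1), 0]
  | .j4, x, y => ![0, x 0 * y 0, x 0 * y 1 + x 1 * y 0, 0]
  | .j5 α, x, y => ![0, 0, 0, x 0 * y 0 + x 1 * y 1 + sgn α * (x 2 * y 2)]
  | .j6, x, y => ![0, x 0 * y 0, 0, x 1 * y 2 + x 2 * y 1]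
  | .j7, x, y => ![0, x 0 * y 0, 0, x 0 * y 1 + x 1 * y 0 + x 2 * y 2]
  | .j8 α, x, y => ![0, 0, x 0 * y 0 + sgn α * (x 1 * y 1), x 0 * y 2 + x 2 * y 0]
  | .j9, x, y => ![0, 0, x 0 * y 0 - x 1 * y 1, x 0 * y 2 + x 2 * y 0 + (x 1 * y 2 + x 2 * y 1)]
  | .j10, x, y => ![0, 0, x 0 * y 0 - x 1 * y 1,
      x 0 * y 2 + x 2 * y 0 + (x 1 * y 2 + x 2 * y 1) + (x 0 * y 1 + x 1 * y 0)]
  | .j11, x, y => ![0, x 0 * y 0, x 0 * y 1 + x 1 * y 0, x 0 * y 2 + x 2 * y 0 + x 1 * y 1]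
  | .j12, x, y => ![0, 0, x 0 * y 0, x 0 * y 1 + x 1 * y 0]
  | .j13 α, x, y => ![0, 0, x 0 * y 0 + sgn α * (x 1 * y 1), x 0 * y 1 + x 1 * y 0]

/-- The vector `v` of `ℝ⁴` as an element of `J4 l`. -/
def vec (l : Label) (v : Fin 4 → ℝ) : J4 l := v

theorem vec_inj {l : Label} {v w : Fin 4 → ℝ} : vec l v = vec l w ↔ v = w := Iff.rfl

theorem vec_eq_zero {l : Label} {v : Fin 4 → ℝ} : vec l v = 0 ↔ v = 0 := Iff.rfl

theorem smul_vec {l : Label} (r : ℝ) (v : Fin 4 → ℝ) : r • vec l v = vec l (r • v) := rfl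

theorem forall_vec {l : Label} {P : J4 l → Prop} : (∀ x, P x) ↔ ∀ v, P (vec l v) := Iff.rfl

set_option maxHeartbeats 1000000 in
theorem vec_mul (l : Label) (x y : Fin 4 → ℝ) : vec l x * vec l y = vec l (prod4 l x y) := by
  apply TableAlgebra.ext'
  intro k
  rw [TableAlgebra.mul_apply]
  simp only [Fin.sum_univ_four, vec]
  have h (i j : Fin 4) : e i j = if j = i then 1 else 0 := by simp [e, Pi.single_apply]
  rcases l with _ | _ | α | _ | α | _ | _ | α | _ | _ | _ | _ | α <;> fin_cases k <;>
    simp [table, prod4, h] <;> ring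

/-! ### The list: cardinality, dimension, Jordan identity, nilpotency, associativity. -/

/-- The labels with and without a sign. -/
def labelEquiv : Label ≃ Fin 9 ⊕ Fin 4 × ℤˣ where
  toFun
    | .j1 => .inl 0
    | .j2 => .inl 1
    | .j3 α => .inr (0, α)
    | .j4 => .inl 2
    | .j5 α => .inr (1, α)
    | .j6 => .inl 3
    | .j7 => .inl 4
    | .j8 α => .inr (2, α)
    | .j9 => .inl 5
    | .j10 => .inl 6
    | .j11 => .inl 7
    | .j12 => .inl 8
    | .j13 α => .inr (3, α)
  invFun
    | .inl i => ![.j1, .j2, .j4, .j6, .j7, .j9, .j10, .j11, .j12] i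
    | .inr (i, α) => ![.j3 α, .j5 α, .j8 α, .j13 α] i
  left_inv l := by cases l <;> rfl
  right_inv := by
    rintro (i | ⟨i, α⟩) <;> fin_cases i <;> rfl

theorem card_label : Nat.card Label = 17 := by
  rw [Nat.card_congr labelEquiv]
  simp

theorem finrank_J4 (l : Label) : Module.finrank ℝ (J4 l) = 4 := by
  change Module.finrank ℝ (Fin 4 → ℝ) = 4
  simp

theorem isCommJordan_J4 (l : Label) : IsCommJordan (J4 l) := by
  constructor
  revert l
  rw [Label.forall_iff]
  refine ⟨?_, ?_, ?_, ?_, ?_, ?_, ?_, ?_, ?_, ?_, ?_, ?_, ?_, ?_, ?_, ?_, ?_⟩ <;>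
  · simp only [forall_vec, vec_mul, vec_inj, prod4]
    intro x y
    simp <;> ring

section Nilpotent

variable {A : Type*} [NonUnitalNonAssocCommRing A] [Module ℝ A]
    [IsScalarTower ℝ A A] [SMulCommClass ℝ A A]

theorem lowerCentralSeries_succ_le {m : ℕ} {S : Submodule ℝ A} :
    lowerCentralSeries A (m + 1) ≤ S ↔ ∀ x ∈ lowerCentralSeries A m, ∀ y : A, x * y ∈ S := by
  rw [lowerCentralSeries, Submodule.map₂_le]
  simp

theorem mul_mem_lowerCentralSeries {m : ℕ} {x : A} (hx : x ∈ lowerCentralSeries A m) (y : A) :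
    x * y ∈ lowerCentralSeries A (m + 1) :=
  lowerCentralSeries_succ_le.1 le_rfl x hx y

/-- The elements that every right multiplication takes into `S`. -/
def multiplier (S : Submodule ℝ A) : Submodule ℝ A where
  carrier := {x | ∀ y : A, x * y ∈ S}
  add_mem' ha hb y := by
    rw [add_mul]
    exact S.add_mem (ha y) (hb y)
  zero_mem' y := by simp
  smul_mem' r x hx y := by
    rw [smul_mul_assoc]
    exact S.smul_mem r (hx y)

theorem lowerCentralSeries_succ_le_iff_multiplier {m : ℕ} {S : Submodule ℝ A} :
    lowerCentralSeries A (m + 1) ≤ S ↔ lowerCentralSeries A m ≤ multiplier S :=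
  lowerCentralSeries_succ_le

/-- The series is indexed from 0, so its term 4 is spanned by left-normed products of five factors.
The adjunction with `multiplier` removes one right factor at a time. -/
theorem isNilpotentAlgebra_of_mul_eq_zero (h : ∀ x y z w v : A, x * y * z * w * v = 0) :
    IsNilpotentAlgebra A := by
  refine ⟨4, ?_⟩
  rw [eq_bot_iff]
  iterate 4 rw [lowerCentralSeries_succ_le_iff_multiplier]
  intro x _ y z w v
  exact h x y z w v

end Nilpotent

theorem isNilpotentAlgebra_J4 (l : Label) : IsNilpotentAlgebra (J4 l) := by
  apply isNilpotentAlgebra_of_mul_eq_zero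
  revert l
  rw [Label.forall_iff]
  refine ⟨?_, ?_, ?_, ?_, ?_, ?_, ?_, ?_, ?_, ?_, ?_, ?_, ?_, ?_, ?_, ?_, ?_⟩ <;>
  · simp [forall_vec, vec_mul, vec_eq_zero, prod4]

theorem associative_J4_iff (l : Label) :
    (∀ x y z : J4 l, (x * y) * z = x * (y * z)) ↔ l ∉ Label.nonassociative := by
  constructor
  · rintro h (rfl | ⟨α, rfl⟩ | rfl | rfl)
    · have := h (vec _ ![1, 0, 0, 0]) (vec _ ![1, 0, 0, 0]) (vec _ ![0, 0, 1, 0])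
      simp [vec_inj, vec_mul, prod4] at this
    · have := h (vec _ ![0, 1, 0, 0]) (vec _ ![0, 1, 0, 0]) (vec _ ![1, 0, 0, 0])
      rcases Int.units_eq_one_or α with rfl | rfl <;>
      simp [vec_inj, vec_mul, prod4] at this
    · have := h (vec _ ![1, 0, 0, 0]) (vec _ ![1, 0, 0, 0]) (vec _ ![0, 1, 0, 0])
      simp [vec_inj, vec_mul, prod4] at this
    · have := h (vec _ ![1, 0, 0, 0]) (vec _ ![1, 0, 0, 0]) (vec _ ![0, 1, 0, 0])
      simp [vec_inj, vec_mul, prod4] at this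
  · revert l
    rw [Label.forall_iff]
    simp [Label.nonassociative]
    refine ⟨?_, ?_, ?_, ?_, ?_, ?_, ?_, ?_, ?_, ?_, ?_, ?_⟩ <;>
    · simp only [forall_vec, vec_mul, vec_inj, prod4]
      intro x y z
      simp <;> first | ring1 | exact ⟨by ring, by ring⟩

/-! ### Central components: explicit splittings and an obstruction. -/

/-- Splitting off the last basis vector of `ℝ⁴`. -/
noncomputable def splitLast (T : Fin 4 → Fin 4 → (Fin 4 → ℝ)) (T' : Fin 3 → Fin 3 → (Fin 3 → ℝ)) :
    TableAlgebra T ≃ₗ[ℝ] TableAlgebra T' × J11 where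
  toFun x := ((![x 0, x 1, x 2] : Fin 3 → ℝ), (![x 3] : Fin 1 → ℝ))
  invFun p := (![p.1 0, p.1 1, p.1 2, p.2 0] : Fin 4 → ℝ)
  map_add' x y := by
    refine Prod.ext (TableAlgebra.ext' _ fun k => ?_) (TableAlgebra.ext' _ fun k => ?_)
    · fin_cases k <;> rfl
    · fin_cases k; rfl
  map_smul' r x := by
    refine Prod.ext (TableAlgebra.ext' _ fun k => ?_) (TableAlgebra.ext' _ fun k => ?_)
    · fin_cases k <;> rfl
    · fin_cases k; rfl
  left_inv x := TableAlgebra.ext' _ fun k => by fin_cases k <;> rfl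
  right_inv p := by
    refine Prod.ext (TableAlgebra.ext' _ fun k => ?_) (TableAlgebra.ext' _ fun k => ?_)
    · fin_cases k <;> rfl
    · fin_cases k; rfl

theorem algIso_splitLast {l : Label} {T' : Fin 3 → Fin 3 → (Fin 3 → ℝ)}
    (h : ∀ x y : Fin 4 → ℝ, (show TableAlgebra T' from (![x 0, x 1, x 2] : Fin 3 → ℝ)) *
      (show TableAlgebra T' from (![y 0, y 1, y 2] : Fin 3 → ℝ)) =
      (![prod4 l x y 0, prod4 l x y 1, prod4 l x y 2] : Fin 3 → ℝ))
    (h' : ∀ x y, prod4 l x y 3 = 0) :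
    AlgIso (J4 l) (TableAlgebra T' × J11) := by
  refine ⟨splitLast _ _, forall_vec.2 fun x => forall_vec.2 fun y =>
    Prod.ext ?_ (TableAlgebra.ext' _ fun k => ?_)⟩
  · rw [vec_mul]
    exact (h x y).symm
  · rw [vec_mul, Prod.snd_mul, TableAlgebra.mul_apply]
    fin_cases k
    exact (h' x y).trans (by simp)

theorem algIso_j1 : AlgIso (J4 .j1) (J31 × J11) := by
  refine algIso_splitLast (fun x y => TableAlgebra.ext' _ fun k => ?_) fun x y => by simp [prod4]
  rw [TableAlgebra.mul_apply]
  fin_cases k <;> simp [prod4]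

theorem algIso_j2 : AlgIso (J4 .j2) (J32 × J11) := by
  refine algIso_splitLast (fun x y => TableAlgebra.ext' _ fun k => ?_) fun x y => by simp [prod4]
  rw [TableAlgebra.mul_apply]
  fin_cases k <;> simp [Fin.sum_univ_three, prod4, e]

theorem algIso_j3 (α : ℤˣ) : AlgIso (J4 (.j3 α)) (J33 α × J11) := by
  refine algIso_splitLast (fun x y => TableAlgebra.ext' _ fun k => ?_) fun x y => by simp [prod4]
  rw [TableAlgebra.mul_apply]
  fin_cases k <;> (simp [Fin.sum_univ_three, prod4, e]; try ring)

theorem algIso_j4 : AlgIso (J4 .j4) (J34 × J11) := by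
  refine algIso_splitLast (fun x y => TableAlgebra.ext' _ fun k => ?_) fun x y => by simp [prod4]
  rw [TableAlgebra.mul_apply]
  fin_cases k <;> simp [Fin.sum_univ_three, prod4, e]

theorem hasCentralComponent_of_algIso_prod {A B : Type*} [NonUnitalNonAssocCommRing A] [Module ℝ A]
    [NonUnitalNonAssocRing B] [Module ℝ B] (h : AlgIso A (B × J11)) : HasCentralComponent A := by
  obtain ⟨f, hf⟩ := h
  have zero (x y : J11) : x * y = 0 := TableAlgebra.ext' _ fun k => by
    simp [TableAlgebra.mul_apply, TableAlgebra.zero_apply]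
  refine ⟨LinearMap.ker (LinearMap.snd ℝ B J11 ∘ₗ f.toLinearMap),
    LinearMap.ker (LinearMap.fst ℝ B J11 ∘ₗ f.toLinearMap), ⟨?_, ?_⟩, ?_, ?_, ?_⟩
  · rw [Submodule.disjoint_def]
    intro x h1 h2
    apply f.injective
    rw [map_zero]
    exact Prod.ext h2 h1
  · rw [codisjoint_iff, eq_top_iff]
    intro x _
    rw [Submodule.mem_sup]
    refine ⟨f.symm ((f x).1, 0), by simp, f.symm (0, (f x).2), by simp, ?_⟩
    rw [← map_add]
    simp
  · rw [Submodule.ne_bot_iff]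
    refine ⟨f.symm (0, fun _ => 1), by simp, ?_⟩
    rw [ne_eq, LinearEquiv.map_eq_zero_iff]
    intro h
    exact one_ne_zero (congrFun (congrArg Prod.snd h) 0 : (1 : ℝ) = 0)
  · intro x _ y
    simp [hf, zero]
  · intro x hx y
    have hx : (f x).1 = 0 := hx
    apply f.injective
    rw [hf, map_zero]
    exact Prod.ext (by simp [hx]) (zero _ _)

/-- Let A = K ⊕ I with I A = 0 and write y = k + i. Then y z = k z lies in K, so I contains no
nonzero product. -/
theorem not_hasCentralComponent {A : Type*} [NonUnitalNonAssocCommRing A] [Module ℝ A]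
    (h : ∀ x : A, (∀ y, x * y = 0) → ∃ y z, x = y * z) : ¬ HasCentralComponent A := by
  rintro ⟨K, I, hKI, hI, hK, hI'⟩
  obtain ⟨x, hx, hx0⟩ := (Submodule.ne_bot_iff _).1 hI
  obtain ⟨y, z, rfl⟩ := h x (hI' x hx)
  apply hx0
  refine (Submodule.disjoint_def.1 hKI.disjoint) _ ?_ hx
  obtain ⟨k, hk, i, hi, rfl⟩ : ∃ k ∈ K, ∃ i ∈ I, k + i = y :=
    Submodule.mem_sup.1 (hKI.sup_eq_top ▸ Submodule.mem_top)
  rw [add_mul, hI' i hi, add_zero]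
  exact hK k hk z

/-! ### Isomorphism invariants and their values on the list. -/

section Invariants

variable (A : Type*) [NonUnitalNonAssocCommRing A]

/-- All products vanish. -/
def MulZero : Prop := ∀ x y : A, x * y = 0

/-- All products of three elements vanish. -/
def MulZero₃ : Prop := ∀ x y z : A, x * y * z = 0

/-- All left-normed products of four elements vanish. -/
def MulZero₄ : Prop := ∀ x y z w : A, x * y * z * w = 0

/-- Every element of the annihilator is a product. -/
def AnnIsProduct : Prop := ∀ x : A, (∀ y, x * y = 0) → ∃ y z, x = y * z

/-- Elements of square zero lie in the annihilator. -/
def SqZeroAnn : Prop := ∀ x : A, x * x = 0 → ∀ y, x * y = 0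

/-- If `x * y = 0` then `x` or `y` has square zero. -/
def MulZeroSqZero : Prop := ∀ x y : A, x * y = 0 → x * x = 0 ∨ y * y = 0

/-- If `x * y = 0` then the squares of `x` and `y` are proportional. -/
def MulZeroSqProportional [Module ℝ A] : Prop :=
  ∀ x y : A, x * y = 0 → x * x = 0 ∨ ∃ t : ℝ, y * y = t • (x * x)

/-- `SqZeroAnn` modulo the annihilator. -/
def SqAnnMulAnn : Prop := ∀ x : A, (∀ y, x * x * y = 0) → ∀ y z, x * y * z = 0

/-- `MulZeroSqZero` modulo the annihilator. -/
def MulAnnSqAnn : Prop :=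
  ∀ x y : A, (∀ z, x * y * z = 0) → (∀ z, x * x * z = 0) ∨ ∀ z, y * y * z = 0

/-- Elements that annihilate all products have their squares in the annihilator. -/
def AnnMulSqAnn : Prop := ∀ x : A, (∀ y z, y * z * x = 0) → ∀ y, x * x * y = 0

/-- Elements that annihilate all products have square zero. -/
def AnnMulSqZero : Prop := ∀ x : A, (∀ y z, y * z * x = 0) → x * x = 0

end Invariants

/-- Quantifiers over the target are pulled back along a surjection; equations are then reflected by
injectivity. -/
theorem AlgIso.invariants {A B : Type*} [NonUnitalNonAssocCommRing A] [Module ℝ A]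
    [NonUnitalNonAssocCommRing B] [Module ℝ B] (h : AlgIso A B) :
    ((∀ x y z : A, x * y * z = x * (y * z)) ↔ ∀ x y z : B, x * y * z = x * (y * z)) ∧
    (MulZero A ↔ MulZero B) ∧ (MulZero₃ A ↔ MulZero₃ B) ∧ (MulZero₄ A ↔ MulZero₄ B) ∧
    (AnnIsProduct A ↔ AnnIsProduct B) ∧ (SqZeroAnn A ↔ SqZeroAnn B) ∧
    (MulZeroSqZero A ↔ MulZeroSqZero B) ∧ (MulZeroSqProportional A ↔ MulZeroSqProportional B) ∧
    (SqAnnMulAnn A ↔ SqAnnMulAnn B) ∧ (MulAnnSqAnn A ↔ MulAnnSqAnn B) ∧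
    (AnnMulSqAnn A ↔ AnnMulSqAnn B) ∧ (AnnMulSqZero A ↔ AnnMulSqZero B) := by
  obtain ⟨f, hf⟩ := h
  refine ⟨?_, ?_, ?_, ?_, ?_, ?_, ?_, ?_, ?_, ?_, ?_, ?_⟩ <;>
  simp only [MulZero, MulZero₃, MulZero₄, AnnIsProduct, SqZeroAnn, MulZeroSqZero,
    MulZeroSqProportional, SqAnnMulAnn, MulAnnSqAnn, AnnMulSqAnn, AnnMulSqZero,
    f.surjective.forall, f.surjective.exists, ← hf, f.map_eq_zero_iff, f.injective.eq_iff,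
    ← map_smul]

theorem mulZero₃_J4_iff (l : Label) : MulZero₃ (J4 l) ↔
    l = .j1 ∨ l = .j2 ∨ (∃ α, l = .j3 α) ∨ (∃ α, l = .j5 α) ∨ l = .j12 ∨ ∃ α, l = .j13 α := by
  constructor
  · revert l
    rw [Label.forall_iff]
    simp [MulZero₃]
    refine ⟨?_, ?_, ?_, ?_, ?_, ?_, ?_, ?_⟩
    · exact ⟨vec _ ![1, 0, 0, 0], vec _ ![1, 0, 0, 0], vec _ ![1, 0, 0, 0],
        by simp [vec_mul, vec_eq_zero, prod4]⟩
    · exact ⟨vec _ ![1, 0, 0, 0], vec _ ![1, 0, 0, 0], vec _ ![0, 0, 1, 0],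
        by simp [vec_mul, vec_eq_zero, prod4]⟩
    all_goals exact ⟨vec _ ![1, 0, 0, 0], vec _ ![1, 0, 0, 0], vec _ ![1, 0, 0, 0],
        by simp [vec_mul, vec_eq_zero, prod4]⟩
  · rintro (rfl | rfl | ⟨α, rfl⟩ | ⟨α, rfl⟩ | rfl | ⟨α, rfl⟩) <;>
    simp [MulZero₃, forall_vec, vec_mul, vec_eq_zero, prod4]

/-- The annihilator lies in the last axis, and multiplication by the single vector `u` already
reaches that whole axis. -/
theorem annIsProduct_of_ann_eq_line (l : Label) (u : Fin 4 → ℝ)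
    (h : ∀ v, (∀ w, vec l v * vec l w = 0) → v 0 = 0 ∧ v 1 = 0 ∧ v 2 = 0)
    (h' : ∀ t : ℝ, ∃ v, prod4 l u v = ![0, 0, 0, t]) : AnnIsProduct (J4 l) := by
  refine forall_vec.2 fun v hv => ?_
  obtain ⟨h0, h1, h2⟩ := h v hv
  obtain ⟨w, hw⟩ := h' (v 3)
  refine ⟨vec l u, vec l w, ?_⟩
  rw [vec_mul, vec_inj, hw]
  ext k
  fin_cases k <;> simp [h0, h1, h2]

theorem annIsProduct_of_ann_eq_plane (l : Label) (u : Fin 4 → ℝ)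
    (h : ∀ v, (∀ w, vec l v * vec l w = 0) → v 0 = 0 ∧ v 1 = 0)
    (h' : ∀ s t : ℝ, ∃ v, prod4 l u v = ![0, 0, s, t]) : AnnIsProduct (J4 l) := by
  refine forall_vec.2 fun v hv => ?_
  obtain ⟨h0, h1⟩ := h v hv
  obtain ⟨w, hw⟩ := h' (v 2) (v 3)
  refine ⟨vec l u, vec l w, ?_⟩
  rw [vec_mul, vec_inj, hw]
  ext k
  fin_cases k <;> simp [h0, h1]

/-- The vector d annihilates everything, while every product has zero d-coordinate. -/
theorem not_annIsProduct_J4 (l : Label) (h : l ∈ Label.withCentralComponent) :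
    ¬ AnnIsProduct (J4 l) := by
  intro h'
  rcases h with rfl | rfl | ⟨α, rfl⟩ | rfl
  all_goals
    obtain ⟨y, z, h⟩ := h' (vec _ ![0, 0, 0, 1])
      (by simp [forall_vec, vec_mul, vec_eq_zero, prod4])
    revert y z
    simp [forall_vec, vec_mul, vec_inj, prod4]

set_option maxHeartbeats 1000000 in
theorem annIsProduct_J4_iff (l : Label) :
    AnnIsProduct (J4 l) ↔ l ∉ Label.withCentralComponent := by
  constructor
  · exact fun h hl => not_annIsProduct_J4 l hl h
  · revert l
    rw [Label.forall_iff]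
    simp [Label.withCentralComponent]
    refine ⟨?_, ?_, ?_, ?_, ?_, ?_, ?_, ?_, ?_, ?_, ?_, ?_⟩
    iterate 2
      refine annIsProduct_of_ann_eq_line _ ![1, 0, 0, 0] (fun v hv => ?_)
        fun t => ⟨![t, 0, 0, 0], by simp [prod4]⟩
      have h0 := hv ![1, 0, 0, 0]
      have h1 := hv ![0, 1, 0, 0]
      have h2 := hv ![0, 0, 1, 0]
      simp_all [vec_mul, vec_eq_zero, prod4]
    · refine annIsProduct_of_ann_eq_line _ ![0, 0, 1, 0] (fun v hv => ?_)
        fun t => ⟨![0, t, 0, 0], by simp [prod4]⟩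
      have h0 := hv ![1, 0, 0, 0]
      have h1 := hv ![0, 1, 0, 0]
      have h2 := hv ![0, 0, 1, 0]
      simp_all [vec_mul, vec_eq_zero, prod4]
    · refine annIsProduct_of_ann_eq_line _ ![1, 0, 0, 0] (fun v hv => ?_)
        fun t => ⟨![0, t, 0, 0], by simp [prod4]⟩
      have h0 := hv ![1, 0, 0, 0]
      have h1 := hv ![0, 1, 0, 0]
      have h2 := hv ![0, 0, 1, 0]
      simp_all [vec_mul, vec_eq_zero, prod4]
    iterate 5
      refine annIsProduct_of_ann_eq_line _ ![1, 0, 0, 0] (fun v hv => ?_)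
        fun t => ⟨![0, 0, t, 0], by simp [prod4]⟩
      have h0 := hv ![1, 0, 0, 0]
      have h1 := hv ![0, 1, 0, 0]
      have h2 := hv ![0, 0, 1, 0]
      simp_all [vec_mul, vec_eq_zero, prod4]
    iterate 3
      refine annIsProduct_of_ann_eq_plane _ ![1, 0, 0, 0] (fun v hv => ?_)
        fun s t => ⟨![s, t, 0, 0], by simp [prod4]⟩
      have h0 := hv ![1, 0, 0, 0]
      have h1 := hv ![0, 1, 0, 0]
      simp_all [vec_mul, vec_eq_zero, prod4]

theorem hasCentralComponent_J4_iff (l : Label) :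
    HasCentralComponent (J4 l) ↔ l ∈ Label.withCentralComponent := by
  constructor
  · intro h
    by_contra hl
    exact not_hasCentralComponent ((annIsProduct_J4_iff l).2 hl) h
  · rintro (rfl | rfl | ⟨α, rfl⟩ | rfl)
    · exact hasCentralComponent_of_algIso_prod algIso_j1
    · exact hasCentralComponent_of_algIso_prod algIso_j2
    · exact hasCentralComponent_of_algIso_prod (algIso_j3 α)
    · exact hasCentralComponent_of_algIso_prod algIso_j4

theorem mulZero_J4 : MulZero (J4 .j1) ∧ ¬ MulZero (J4 .j2) ∧ ∀ α, ¬ MulZero (J4 (.j3 α)) := by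
  refine ⟨?_, fun h => ?_, fun α h => ?_⟩
  · simp [MulZero, forall_vec, vec_mul, vec_eq_zero, prod4]
  all_goals
    have := h (vec _ ![1, 0, 0, 0]) (vec _ ![1, 0, 0, 0])
    simp [vec_mul, vec_eq_zero, prod4] at this

theorem mulZero₄_J4 : MulZero₄ (J4 .j7) ∧ ¬ MulZero₄ (J4 .j11) := by
  refine ⟨?_, fun h => ?_⟩
  · simp [MulZero₄, forall_vec, vec_mul, vec_eq_zero, prod4]
  · have := h (vec _ ![1, 0, 0, 0]) (vec _ ![1, 0, 0, 0]) (vec _ ![1, 0, 0, 0])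
      (vec _ ![1, 0, 0, 0])
    simp [vec_mul, vec_eq_zero, prod4] at this

theorem sq_add_sq_eq_zero {a b : ℝ} (h : a * a + b * b = 0) : a = 0 ∧ b = 0 :=
  ⟨by nlinarith [mul_self_nonneg a, mul_self_nonneg b],
    by nlinarith [mul_self_nonneg a, mul_self_nonneg b]⟩

/-- The property says that the vector-valued quadratic form x ↦ x² has no isotropic vectors outside
its radical. It holds for the definite forms, and for `j13 (-1)` because (x² - y², 2xy) is
essentially complex squaring. -/
theorem sqZeroAnn_J4 : SqZeroAnn (J4 .j2) ∧ SqZeroAnn (J4 (.j3 1)) ∧ ¬ SqZeroAnn (J4 (.j3 (-1))) ∧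
    SqZeroAnn (J4 (.j5 1)) ∧ ¬ SqZeroAnn (J4 (.j5 (-1))) ∧ ¬ SqZeroAnn (J4 .j12) ∧
    SqZeroAnn (J4 (.j13 1)) ∧ SqZeroAnn (J4 (.j13 (-1))) := by
  refine ⟨?_, ?_, ?_, ?_, ?_, ?_, ?_, ?_⟩
  · simp +contextual [SqZeroAnn, forall_vec, vec_mul, vec_eq_zero, prod4]
  · refine forall_vec.2 fun v h => ?_
    simp [vec_mul, vec_eq_zero, prod4] at h
    obtain ⟨h0, h1⟩ := sq_add_sq_eq_zero h
    simp [forall_vec, vec_mul, vec_eq_zero, prod4, h0, h1]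
  · intro h
    have := h (vec _ ![1, 1, 0, 0]) (by simp [vec_mul, vec_eq_zero, prod4]) (vec _ ![1, 0, 0, 0])
    simp [vec_mul, vec_eq_zero, prod4] at this
  · refine forall_vec.2 fun v h => ?_
    simp [vec_mul, vec_eq_zero, prod4] at h
    obtain ⟨h0, h2⟩ : v 0 * v 0 + v 1 * v 1 = 0 ∧ v 2 * v 2 = 0 := by
      constructor <;> linarith [mul_self_nonneg (v 0), mul_self_nonneg (v 1),
        mul_self_nonneg (v 2)]
    obtain ⟨h0, h1⟩ := sq_add_sq_eq_zero h0
    rw [mul_self_eq_zero] at h2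
    simp [forall_vec, vec_mul, vec_eq_zero, prod4, h0, h1, h2]
  · intro h
    have := h (vec _ ![1, 0, 1, 0]) (by simp [vec_mul, vec_eq_zero, prod4]) (vec _ ![1, 0, 0, 0])
    simp [vec_mul, vec_eq_zero, prod4] at this
  · intro h
    have := h (vec _ ![0, 1, 0, 0]) (by simp [vec_mul, vec_eq_zero, prod4]) (vec _ ![1, 0, 0, 0])
    simp [vec_mul, vec_eq_zero, prod4] at this
  · refine forall_vec.2 fun v h => ?_
    simp [vec_mul, vec_eq_zero, prod4] at h
    obtain ⟨h0, h1⟩ := sq_add_sq_eq_zero h.1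
    simp [forall_vec, vec_mul, vec_eq_zero, prod4, h0, h1]
  · refine forall_vec.2 fun v h => ?_
    simp [vec_mul, vec_eq_zero, prod4] at h
    have h' : v 0 * v 1 = 0 := by linarith [h.2]
    have h0 : v 0 = 0 ∧ v 1 = 0 := by
      rcases mul_eq_zero.1 h' with h' | h' <;> simpa [h'] using h.1
    simp [forall_vec, vec_mul, vec_eq_zero, prod4, h0]

/-- Modulo A², `j13 (-1)` multiplies like the complex numbers, which have no zero divisors, whereas
`j13 1` multiplies like the split complex numbers, where (1, 1) and (1, -1) have product zero. -/
theorem mulZeroSqZero_J4 : MulZeroSqZero (J4 .j2) ∧ ¬ MulZeroSqZero (J4 (.j3 1)) ∧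
    ¬ MulZeroSqZero (J4 (.j5 1)) ∧ ¬ MulZeroSqZero (J4 (.j5 (-1))) ∧ MulZeroSqZero (J4 .j12) ∧
    ¬ MulZeroSqZero (J4 (.j13 1)) ∧ MulZeroSqZero (J4 (.j13 (-1))) := by
  refine ⟨?_, ?_, ?_, ?_, ?_, ?_, ?_⟩
  · simp [MulZeroSqZero, forall_vec, vec_mul, vec_eq_zero, prod4]
  iterate 3
    intro h
    have := h (vec _ ![1, 0, 0, 0]) (vec _ ![0, 1, 0, 0]) (by simp [vec_mul, vec_eq_zero, prod4])
    simp [vec_mul, vec_eq_zero, prod4] at this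
  · refine forall_vec.2 fun v => forall_vec.2 fun w h => ?_
    simp [vec_mul, vec_eq_zero, prod4] at h ⊢
    rcases h.1 with h | h <;> simp [h]
  · intro h
    have := h (vec _ ![1, 1, 0, 0]) (vec _ ![1, -1, 0, 0])
      (by simp [vec_mul, vec_eq_zero, prod4])
    simp [vec_mul, vec_eq_zero, prod4] at this
  · refine forall_vec.2 fun v => forall_vec.2 fun w h => ?_
    simp [vec_mul, vec_eq_zero, prod4] at h ⊢
    -- Multiplicativity of the complex norm.
    have h' : (v 0 * v 0 + v 1 * v 1) * (w 0 * w 0 + w 1 * w 1) = 0 := by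
      linear_combination (v 0 * w 0 - v 1 * w 1) * h.1 + (v 0 * w 1 + v 1 * w 0) * h.2
    rcases mul_eq_zero.1 h' with h' | h'
    · obtain ⟨h0, h1⟩ := sq_add_sq_eq_zero h'
      simp [h0, h1]
    · obtain ⟨h0, h1⟩ := sq_add_sq_eq_zero h'
      simp [h0, h1]

theorem mulZeroSqProportional_J4 :
    MulZeroSqProportional (J4 (.j5 1)) ∧ ¬ MulZeroSqProportional (J4 (.j13 1)) := by
  constructor
  · refine forall_vec.2 fun v => forall_vec.2 fun w _ => ?_
    simp only [vec_mul, vec_eq_zero, prod4, smul_vec, vec_inj]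
    by_cases h : v 0 * v 0 + v 1 * v 1 + v 2 * v 2 = 0
    · simp [h]
    · right
      exact ⟨(w 0 * w 0 + w 1 * w 1 + w 2 * w 2) / (v 0 * v 0 + v 1 * v 1 + v 2 * v 2),
        by simp [h]⟩
  · intro h
    have := h (vec _ ![1, 1, 0, 0]) (vec _ ![1, -1, 0, 0])
      (by simp [vec_mul, vec_eq_zero, prod4])
    simp [vec_mul, vec_eq_zero, prod4, smul_vec, vec_inj] at this
    norm_num at this

/-- In these five algebras the annihilator is the line of d. Modulo it, the squaring form has rank
one for `j6`, is definite for `j8 1` and hyperbolic for the other three. -/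
theorem sqAnnMulAnn_J4 : SqAnnMulAnn (J4 .j6) ∧ SqAnnMulAnn (J4 (.j8 1)) ∧
    ¬ SqAnnMulAnn (J4 (.j8 (-1))) ∧ ¬ SqAnnMulAnn (J4 .j9) ∧ ¬ SqAnnMulAnn (J4 .j10) := by
  refine ⟨?_, ?_, ?_, ?_, ?_⟩
  · refine forall_vec.2 fun v h => ?_
    have h := h (vec _ ![0, 0, 1, 0])
    simp [vec_mul, vec_eq_zero, prod4] at h
    simp [forall_vec, vec_mul, vec_eq_zero, prod4, h]
  · refine forall_vec.2 fun v h => ?_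
    have h := h (vec _ ![1, 0, 0, 0])
    simp [vec_mul, vec_eq_zero, prod4] at h
    obtain ⟨h0, h1⟩ := sq_add_sq_eq_zero h
    simp [forall_vec, vec_mul, vec_eq_zero, prod4, h0, h1]
  all_goals
    intro h
    have := h (vec _ ![1, 1, 0, 0]) (by simp [forall_vec, vec_mul, vec_eq_zero, prod4])
      (vec _ ![1, 0, 0, 0]) (vec _ ![1, 0, 0, 0])
    simp [vec_mul, vec_eq_zero, prod4] at this

theorem mulAnnSqAnn_J4 : MulAnnSqAnn (J4 .j6) ∧ ¬ MulAnnSqAnn (J4 (.j8 1)) := by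
  constructor
  · refine forall_vec.2 fun v => forall_vec.2 fun w h => ?_
    have h := h (vec _ ![0, 0, 1, 0])
    simp [vec_mul, vec_eq_zero, prod4] at h
    rcases h with h | h <;> simp [forall_vec, vec_mul, vec_eq_zero, prod4, h]
  · intro h
    have := h (vec _ ![1, 0, 0, 0]) (vec _ ![0, 1, 0, 0])
      (by simp [forall_vec, vec_mul, vec_eq_zero, prod4])
    rcases this with h | h
    all_goals
      have := h (vec _ ![1, 0, 0, 0])
      simp [vec_mul, vec_eq_zero, prod4] at this

/-- The elements killing A² determine a line modulo A². For the hyperbolic form this line is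
isotropic in `j9` and `j10`, but not in `j8 (-1)`. -/
theorem annMulSqAnn_J4 :
    ¬ AnnMulSqAnn (J4 (.j8 (-1))) ∧ AnnMulSqAnn (J4 .j9) ∧ AnnMulSqAnn (J4 .j10) := by
  refine ⟨fun h => ?_, ?_, ?_⟩
  · have := h (vec _ ![0, 1, 0, 0]) (by simp [forall_vec, vec_mul, vec_eq_zero, prod4])
      (vec _ ![1, 0, 0, 0])
    simp [vec_mul, vec_eq_zero, prod4] at this
  all_goals
    refine forall_vec.2 fun v h => ?_
    have h := h (vec _ ![1, 0, 0, 0]) (vec _ ![1, 0, 0, 0])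
    simp [vec_mul, vec_eq_zero, prod4] at h
    have h' : v 0 = - v 1 := by linarith
    simp [forall_vec, vec_mul, vec_eq_zero, prod4, h']

/-- The isotropic line is spanned by a - b, whose square is 0 in `j9` and -2d in `j10`. -/
theorem annMulSqZero_J4 : AnnMulSqZero (J4 .j9) ∧ ¬ AnnMulSqZero (J4 .j10) := by
  refine ⟨?_, fun h => ?_⟩
  · refine forall_vec.2 fun v h => ?_
    have h := h (vec _ ![1, 0, 0, 0]) (vec _ ![1, 0, 0, 0])
    simp [vec_mul, vec_eq_zero, prod4] at h
    have h' : v 0 = - v 1 := by linarith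
    simp [vec_mul, vec_eq_zero, prod4, h']
    ring
  · have := h (vec _ ![1, -1, 0, 0]) (by simp [forall_vec, vec_mul, vec_eq_zero, prod4])
    simp [vec_mul, vec_eq_zero, prod4] at this

theorem not_algIso_J4 (l l' : Label) (hne : l ≠ l') : ¬ AlgIso (J4 l) (J4 l') := by
  intro h
  obtain ⟨h1, h2, h3, h4, h5, h6, h7, h8, h9, h10, h11, h12⟩ := h.invariants
  clear h
  rw [associative_J4_iff, associative_J4_iff] at h1
  rw [mulZero₃_J4_iff, mulZero₃_J4_iff] at h3
  rw [annIsProduct_J4_iff, annIsProduct_J4_iff] at h5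
  revert l'
  revert l
  rw [Label.forall_iff]
  refine ⟨?_, ?_, ?_, ?_, ?_, ?_, ?_, ?_, ?_, ?_, ?_, ?_, ?_, ?_, ?_, ?_, ?_⟩ <;>
  · rw [Label.forall_iff]
    simp +contextual [Label.nonassociative, Label.withCentralComponent, mulZero_J4, mulZero₄_J4,
      sqZeroAnn_J4, mulZeroSqZero_J4, mulZeroSqProportional_J4, sqAnnMulAnn_J4, mulAnnSqAnn_J4,
      annMulSqAnn_J4, annMulSqZero_J4]

/-! ### Adapted families and their normal forms. -/

section Models

variable {A : Type*} [NonUnitalNonAssocCommRing A] [Module ℝ A]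

/-- A spanning family `a, b, c, d` with `a * c = d`, with `b * c` and `c * c` zero, with `d` in the
annihilator, and with prescribed products of `a` and `b`. -/
structure IsAdapted (a b c d : A) (p₁ p₂ q₁ q₂ r₁ r₂ : ℝ) : Prop where
  span : ∀ S : Submodule ℝ A, a ∈ S → b ∈ S → c ∈ S → d ∈ S → S = ⊤
  aa : a * a = p₁ • c + p₂ • d
  ab : a * b = q₁ • c + q₂ • d
  bb : b * b = r₁ • c + r₂ • d
  ac : a * c = d
  bc : b * c = 0
  cc : c * c = 0
  mul_d : ∀ x, x * d = 0

namespace IsAdapted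

variable {a b c d : A} {p₁ p₂ q₁ q₂ r₁ r₂ : ℝ}

theorem ba (h : IsAdapted a b c d p₁ p₂ q₁ q₂ r₁ r₂) : b * a = q₁ • c + q₂ • d :=
  (mul_comm b a).trans h.ab

theorem ca (h : IsAdapted a b c d p₁ p₂ q₁ q₂ r₁ r₂) : c * a = d :=
  (mul_comm c a).trans h.ac

theorem cb (h : IsAdapted a b c d p₁ p₂ q₁ q₂ r₁ r₂) : c * b = 0 :=
  (mul_comm c b).trans h.bc

theorem d_mul (h : IsAdapted a b c d p₁ p₂ q₁ q₂ r₁ r₂) (x : A) : d * x = 0 :=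
  (mul_comm d x).trans (h.mul_d x)

end IsAdapted

variable [IsScalarTower ℝ A A] [SMulCommClass ℝ A A]

/-- As many spanning vectors as the dimension form a basis, so linear independence never has to be
checked separately. -/
theorem algIso_tableAlgebra_of_span {n : ℕ} (T : Fin n → Fin n → (Fin n → ℝ))
    (hA : Module.finrank ℝ A = n) (v : Fin n → A)
    (hspan : ∀ S : Submodule ℝ A, (∀ i, v i ∈ S) → S = ⊤)
    (hmul : ∀ i j, i ≤ j → v i * v j = ∑ k, T i j k • v k) : AlgIso A (TableAlgebra T) := by
  have hmul' (i j : Fin n) : v i * v j = ∑ k, T (min i j) (max i j) k • v k := by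
    rcases le_total i j with h | h
    · rw [min_eq_left h, max_eq_right h, hmul i j h]
    · rw [min_eq_right h, max_eq_left h, mul_comm, hmul j i h]
  let B : Module.Basis (Fin n) ℝ A := basisOfTopLeSpanOfCardEqFinrank v
    (hspan (Submodule.span ℝ (Set.range v)) fun i => Submodule.subset_span ⟨i, rfl⟩).ge
    (by simp [hA])
  have hB (i : Fin n) : B i = v i := by simp [B]
  let g : TableAlgebra T ≃ₗ[ℝ] A := B.equivFun.symm
  have hg (x : TableAlgebra T) : g x = ∑ i, x i • v i := by
    simp only [← hB]
    exact B.equivFun_symm_apply x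
  have key (x y : TableAlgebra T) : g (x * y) = g x * g y := by
    simp only [hg, Finset.sum_mul_sum, smul_mul_smul_comm, hmul', TableAlgebra.mul_apply,
      Finset.sum_smul, Finset.smul_sum, smul_smul]
    rw [Finset.sum_comm]
    refine Finset.sum_congr rfl fun i _ => ?_
    rw [Finset.sum_comm]
  refine ⟨g.symm, fun x y => g.injective ?_⟩
  rw [key]
  simp

/-- A linear combination of four vectors. -/
def comb (a b c d : A) (t : Fin 4 → ℝ) : A := t 0 • a + t 1 • b + t 2 • c + t 3 • d

theorem algIso_J4_of_span (l : Label) (hA : Module.finrank ℝ A = 4) {a b c d : A}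
    (hspan : ∀ S : Submodule ℝ A, a ∈ S → b ∈ S → c ∈ S → d ∈ S → S = ⊤)
    (haa : a * a = comb a b c d (table l 0 0)) (hab : a * b = comb a b c d (table l 0 1))
    (hac : a * c = comb a b c d (table l 0 2)) (had : a * d = comb a b c d (table l 0 3))
    (hbb : b * b = comb a b c d (table l 1 1)) (hbc : b * c = comb a b c d (table l 1 2))
    (hbd : b * d = comb a b c d (table l 1 3)) (hcc : c * c = comb a b c d (table l 2 2))
    (hcd : c * d = comb a b c d (table l 2 3)) (hdd : d * d = comb a b c d (table l 3 3)) :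
    AlgIso A (J4 l) := by
  refine algIso_tableAlgebra_of_span _ hA ![a, b, c, d]
    (fun S hS => hspan S (hS 0) (hS 1) (hS 2) (hS 3)) fun i j hij => ?_
  rw [Fin.sum_univ_four]
  fin_cases i <;> fin_cases j <;> first | assumption | exact absurd hij (by decide)

namespace IsAdapted

variable {a b c d : A} {p₁ p₂ q₁ q₂ r₁ r₂ : ℝ}

/-- Since bc = c² = 0, the elements c and d are unaffected. The parameter `k` acts by congruence on
the coefficients, while `m` and `n` move only the d-coordinates of a² and ab. -/
theorem shear (h : IsAdapted a b c d p₁ p₂ q₁ q₂ r₁ r₂) (k m n : ℝ) :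
    IsAdapted (a + k • b + m • c) (b + n • c) c d (p₁ + 2 * k * q₁ + k ^ 2 * r₁)
      (p₂ + 2 * k * q₂ + k ^ 2 * r₂ + 2 * m) (q₁ + k * r₁) (q₂ + k * r₂ + n) r₁ r₂ where
  span S ha hb hc hd := by
    have hb' : b ∈ S := by simpa using S.sub_mem hb (S.smul_mem n hc)
    have ha' : a ∈ S := by
      simpa using S.sub_mem (S.sub_mem ha (S.smul_mem m hc)) (S.smul_mem k hb')
    exact h.span S ha' hb' hc hd
  aa := by
    simp only [add_mul, mul_add, smul_mul_assoc, mul_smul_comm, h.aa, h.ab, h.ba, h.bb, h.ac, h.ca,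
      h.bc, h.cb, h.cc]
    module
  ab := by
    simp only [add_mul, mul_add, smul_mul_assoc, mul_smul_comm, h.ab, h.bb, h.ac,
      h.bc, h.cb, h.cc]
    module
  bb := by
    simp only [add_mul, mul_add, smul_mul_assoc, mul_smul_comm, h.bb, h.bc, h.cb, h.cc]
    module
  ac := by
    simp only [add_mul, smul_mul_assoc, h.ac, h.bc, h.cc]
    module
  bc := by
    simp only [add_mul, smul_mul_assoc, h.bc, h.cc]
    module
  cc := h.cc
  mul_d := h.mul_d

/-- Changing c to x c + y d forces d to become x d, because ac = d must persist. The hypotheses give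
the old coefficients in terms of the new ones, which avoids division. -/
theorem rescale_sq (h : IsAdapted a b c d p₁ p₂ q₁ q₂ r₁ r₂) {x : ℝ} (hx : x ≠ 0) (y : ℝ)
    {p₁' p₂' q₁' q₂' r₁' r₂' : ℝ} (hp₁ : p₁ = p₁' * x) (hp₂ : p₂ = p₁' * y + p₂' * x)
    (hq₁ : q₁ = q₁' * x) (hq₂ : q₂ = q₁' * y + q₂' * x)
    (hr₁ : r₁ = r₁' * x) (hr₂ : r₂ = r₁' * y + r₂' * x) :
    IsAdapted a b (x • c + y • d) (x • d) p₁' p₂' q₁' q₂' r₁' r₂' where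
  span S ha hb hc hd := by
    have hd' : d ∈ S := (S.smul_mem_iff hx).1 hd
    have hc' : x • c ∈ S := by simpa using S.sub_mem hc (S.smul_mem y hd')
    exact h.span S ha hb ((S.smul_mem_iff hx).1 hc') hd'
  aa := by
    rw [h.aa, hp₁, hp₂]
    module
  ab := by
    rw [h.ab, hq₁, hq₂]
    module
  bb := by
    rw [h.bb, hr₁, hr₂]
    module
  ac := by simp [mul_add, mul_smul_comm, h.ac, h.mul_d]
  bc := by simp [mul_add, mul_smul_comm, h.bc, h.mul_d]
  cc := by simp [mul_add, add_mul, mul_smul_comm, smul_mul_assoc, h.cc, h.mul_d, h.d_mul]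
  mul_d z := by simp [mul_smul_comm, h.mul_d]

theorem rescale (h : IsAdapted a b c d p₁ p₂ q₁ q₂ r₁ r₂) {s t : ℝ} (hs : s ≠ 0) (ht : t ≠ 0) :
    IsAdapted (s • a) (t • b) c (s • d) (s ^ 2 * p₁) (s * p₂) (s * t * q₁) (t * q₂) (t ^ 2 * r₁)
      (t ^ 2 / s * r₂) where
  span S ha hb hc hd := h.span S ((S.smul_mem_iff hs).1 ha) ((S.smul_mem_iff ht).1 hb) hc
    ((S.smul_mem_iff hs).1 hd)
  aa := by
    simp only [smul_mul_assoc, mul_smul_comm, h.aa]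
    module
  ab := by
    simp only [smul_mul_assoc, mul_smul_comm, h.ab]
    module
  bb := by
    simp only [smul_mul_assoc, mul_smul_comm, h.bb, smul_smul, smul_add]
    congr 2
    · ring
    · field_simp
  ac := by simp [smul_mul_assoc, h.ac]
  bc := by simp [smul_mul_assoc, h.bc]
  cc := h.cc
  mul_d x := by simp [mul_smul_comm, h.mul_d]

theorem algIso_j4 (hA : Module.finrank ℝ A = 4) (h : IsAdapted a b c d 1 0 0 0 0 0) :
    AlgIso A (J4 .j4) := by
  refine algIso_J4_of_span .j4 hA (a := a) (b := c) (c := d) (d := b)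
    (fun S ha hc hd hb => h.span S ha hb hc hd) ?_ ?_ ?_ ?_ ?_ ?_ ?_ ?_ ?_ ?_
  all_goals simp [comb, table, e, h.aa, h.ab, h.ac, h.mul_d, h.cc, h.cb, h.d_mul, h.bb]

theorem algIso_j6 (hA : Module.finrank ℝ A = 4) (h : IsAdapted a b c d 0 0 0 0 1 0) :
    AlgIso A (J4 .j6) := by
  refine algIso_J4_of_span .j6 hA (a := b) (b := c) (c := a) (d := d)
    (fun S hb hc ha hd => h.span S ha hb hc hd) ?_ ?_ ?_ ?_ ?_ ?_ ?_ ?_ ?_ ?_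
  all_goals simp [comb, table, e, h.aa, h.ba, h.ca, h.mul_d, h.cc, h.bc, h.bb]

theorem algIso_j7 (hA : Module.finrank ℝ A = 4) (h : IsAdapted a b c d 1 0 0 0 0 1) :
    AlgIso A (J4 .j7) := by
  refine algIso_J4_of_span .j7 hA (a := a) (b := c) (c := b) (d := d)
    (fun S ha hc hb hd => h.span S ha hb hc hd) ?_ ?_ ?_ ?_ ?_ ?_ ?_ ?_ ?_ ?_
  all_goals simp [comb, table, e, h.aa, h.ab, h.ac, h.mul_d, h.cc, h.cb, h.bb]

theorem algIso_j8 (hA : Module.finrank ℝ A = 4) (α : ℤˣ)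
    (h : IsAdapted a b c d 1 0 0 0 (sgn α) 0) : AlgIso A (J4 (.j8 α)) := by
  refine algIso_J4_of_span (.j8 α) hA h.span ?_ ?_ ?_ ?_ ?_ ?_ ?_ ?_ ?_ ?_
  all_goals simp [comb, table, e, h.aa, h.ab, h.ac, h.mul_d, h.cc, h.bc, h.bb]

theorem algIso_j9 (hA : Module.finrank ℝ A = 4) (h : IsAdapted a b c d 0 0 1 0 0 0) :
    AlgIso A (J4 .j9) := by
  refine algIso_J4_of_span .j9 hA (a := a + b) (b := a - b) (c := (2 : ℝ) • c) (d := (2 : ℝ) • d)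
    (fun S ha hb hc hd => ?_) ?_ ?_ ?_ ?_ ?_ ?_ ?_ ?_ ?_ ?_
  · have ha' : a ∈ S := by
      rw [show a = (1 / 2 : ℝ) • ((a + b) + (a - b)) by module]
      exact S.smul_mem _ (S.add_mem ha hb)
    exact h.span S ha' ((S.add_mem_iff_right ha').1 ha) ((S.smul_mem_iff two_ne_zero).1 hc)
      ((S.smul_mem_iff two_ne_zero).1 hd)
  all_goals
    simp only [add_mul, mul_add, sub_mul, mul_sub, smul_mul_assoc, mul_smul_comm,
      h.aa, h.ab, h.ba, h.bb, h.ac, h.bc, h.cc, h.mul_d]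
    simp [comb, table, e]
    try module

theorem algIso_j10 (hA : Module.finrank ℝ A = 4) {r : ℝ} (hr : r ≠ 0)
    (h : IsAdapted a b c d 0 0 1 0 0 r) : AlgIso A (J4 .j10) := by
  have h2 : -2 * r ^ 2 ≠ 0 := by simpa using hr
  have h3 : -2 * r ^ 3 ≠ 0 := by simpa using hr
  -- The isotropic pair a, b becomes a hyperbolic pair r(a ∓ b). Subtracting (r² / 2) c cancels the
  -- d-component r³ that r b² contributes to both squares.
  refine algIso_J4_of_span .j10 hA (a := r • a - r • b - (r ^ 2 / 2) • c)
    (b := r • a + r • b - (r ^ 2 / 2) • c) (c := (-2 * r ^ 2) • c) (d := (-2 * r ^ 3) • d)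
    (fun S ha hb hc hd => ?_) ?_ ?_ ?_ ?_ ?_ ?_ ?_ ?_ ?_ ?_
  · have hc := (S.smul_mem_iff h2).1 hc
    have ha' : a ∈ S := by
      refine (S.smul_mem_iff (mul_ne_zero two_ne_zero hr)).1 ?_
      rw [show (2 * r) • a = (r • a - r • b - (r ^ 2 / 2) • c) +
        (r • a + r • b - (r ^ 2 / 2) • c) + (r ^ 2) • c by module]
      exact S.add_mem (S.add_mem ha hb) (S.smul_mem _ hc)
    have hb' : b ∈ S := by
      refine (S.smul_mem_iff hr).1 ?_
      rw [show r • b = (r • a + r • b - (r ^ 2 / 2) • c) - r • a + (r ^ 2 / 2) • c by module]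
      exact S.add_mem (S.sub_mem hb (S.smul_mem _ ha')) (S.smul_mem _ hc)
    exact h.span S ha' hb' hc ((S.smul_mem_iff h3).1 hd)
  all_goals
    simp only [add_mul, mul_add, sub_mul, mul_sub, smul_mul_assoc, mul_smul_comm,
      h.aa, h.ab, h.ba, h.bb, h.ac, h.bc, h.ca, h.cb, h.cc, h.mul_d]
    simp [comb, table, e]
    try module

/-- Reduction to normal form of an adapted family. -/
theorem exists_algIso (hA : Module.finrank ℝ A = 4) (h : IsAdapted a b c d p₁ p₂ q₁ q₂ r₁ r₂)
    (hne : p₁ ≠ 0 ∨ q₁ ≠ 0 ∨ r₁ ≠ 0) : ∃ l, AlgIso A (J4 l) := by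
  -- The triple (p₁, q₁, r₁) is the quadratic form modulo d. If r₁ ≠ 0, the line of b is not
  -- isotropic (`j6`, `j8`). If r₁ = 0 and q₁ ≠ 0, the form is hyperbolic and b is isotropic (`j9`,
  -- `j10`). Otherwise the form has rank one with b in its radical (`j4`, `j7`).
  by_cases hr : r₁ = 0
  · by_cases hq : q₁ = 0
    · subst hr hq
      have hp : p₁ ≠ 0 := by simpa using hne
      obtain ⟨r, hr⟩ : ∃ r, r₂ = r * p₁ := ⟨r₂ / p₁, by field_simp⟩
      have h' := (h.shear 0 0 (-q₂)).rescale_sq hp p₂ (p₁' := 1) (p₂' := 0) (q₁' := 0) (q₂' := 0)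
        (r₁' := 0) (r₂' := r) (by ring) (by ring) (by ring) (by ring) (by ring) (by rw [hr]; ring)
      by_cases hr0 : r = 0
      · subst hr0
        exact ⟨_, h'.algIso_j4 hA⟩
      · exact ⟨_, ((h'.rescale hr0 hr0).rescale_sq (pow_ne_zero 2 hr0) 0 (p₁' := 1) (p₂' := 0)
          (q₁' := 0) (q₂' := 0) (r₁' := 0) (r₂' := 1) (by ring) (by ring) (by ring) (by ring)
          (by ring) (by field_simp; ring)).algIso_j7 hA⟩
    · subst hr
      obtain ⟨k, hk⟩ : ∃ k, p₁ + 2 * k * q₁ = 0 := ⟨-p₁ / (2 * q₁), by field_simp; ring⟩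
      obtain ⟨m, hm⟩ : ∃ m, p₂ + 2 * k * q₂ + k ^ 2 * r₂ + 2 * m = 0 :=
        ⟨-(p₂ + 2 * k * q₂ + k ^ 2 * r₂) / 2, by ring⟩
      obtain ⟨r, hr⟩ : ∃ r, r₂ = r * q₁ := ⟨r₂ / q₁, by field_simp⟩
      have h' := (h.shear k m 0).rescale_sq hq (q₂ + k * r₂) (p₁' := 0) (p₂' := 0) (q₁' := 1)
        (q₂' := 0) (r₁' := 0) (r₂' := r) (by linear_combination hk) (by linear_combination hm)
        (by ring) (by ring) (by ring) (by rw [hr]; ring)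
      by_cases hr0 : r = 0
      · subst hr0
        exact ⟨_, h'.algIso_j9 hA⟩
      · exact ⟨_, h'.algIso_j10 hA hr0⟩
  · obtain ⟨k, hk⟩ : ∃ k, q₁ + k * r₁ = 0 := ⟨-q₁ / r₁, by field_simp; ring⟩
    -- The new c will be b²; this `m` makes the new a² an exact multiple of it.
    obtain ⟨m, hm⟩ : ∃ m, p₂ + 2 * k * q₂ + k ^ 2 * r₂ + 2 * m =
        (p₁ + 2 * k * q₁ + k ^ 2 * r₁) / r₁ * r₂ :=
      ⟨((p₁ + 2 * k * q₁ + k ^ 2 * r₁) / r₁ * r₂ - (p₂ + 2 * k * q₂ + k ^ 2 * r₂)) / 2, by ring⟩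
    have h' := (h.shear k m (-(q₂ + k * r₂))).rescale_sq hr r₂
      (p₁' := (p₁ + 2 * k * q₁ + k ^ 2 * r₁) / r₁) (p₂' := 0)
      (q₁' := 0) (q₂' := 0) (r₁' := 1) (r₂' := 0) (by field_simp) (by linear_combination hm)
      (by linear_combination hk) (by ring) (by ring) (by ring)
    generalize (p₁ + 2 * k * q₁ + k ^ 2 * r₁) / r₁ = p at h'
    by_cases hp : p = 0
    · subst hp
      exact ⟨_, h'.algIso_j6 hA⟩
    · have hs : √|p| ≠ 0 := by simpa [Real.sqrt_eq_zero'] using hp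
      have hs2 : √|p| ^ 2 = |p| := Real.sq_sqrt (abs_nonneg p)
      -- Now a² = p c and b² = |p| c; replacing c by p c leaves the coefficients 1 and sign p.
      have h'' := h'.rescale one_ne_zero hs
      rcases lt_or_gt_of_ne hp with hp' | hp'
      · have hs2 := hs2.trans (abs_of_neg hp')
        exact ⟨_, (h''.rescale_sq hp 0 (p₁' := 1) (p₂' := 0) (q₁' := 0) (q₂' := 0)
          (r₁' := sgn (-1)) (r₂' := 0) (by ring) (by ring) (by ring) (by ring)
          (by rw [hs2, sgn_neg_one]; ring) (by ring)).algIso_j8 hA (-1)⟩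
      · have hs2 := hs2.trans (abs_of_pos hp')
        exact ⟨_, (h''.rescale_sq hp 0 (p₁' := 1) (p₂' := 0) (q₁' := 0) (q₂' := 0)
          (r₁' := sgn 1) (r₂' := 0) (by ring) (by ring) (by ring) (by ring)
          (by rw [hs2, sgn_one]; ring)
          (by ring)).algIso_j8 hA 1⟩

end IsAdapted

end Models

/-! ### Signs and spanning sets. -/

theorem exists_sq_mul_eq_sign (r : ℝ) : ∃ c : ℝ, c ≠ 0 ∧ c ^ 2 * r = (SignType.sign r : ℝ) := by
  by_cases hr : r = 0
  · exact ⟨1, one_ne_zero, by simp [hr]⟩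
  · have hs : √|r| ≠ 0 := by simpa [Real.sqrt_eq_zero'] using hr
    refine ⟨(√|r|)⁻¹, inv_ne_zero hs, ?_⟩
    rw [inv_pow, Real.sq_sqrt (abs_nonneg r)]
    nth_rewrite 2 [← sign_mul_abs r]
    field_simp

/-- The signature of a ternary form up to an overall sign: `ε` corresponds to replacing the
generator of A² by its negative. The 27 sign patterns are checked by `decide`. -/
theorem exists_perm_sign_normal_form : ∀ s : Fin 3 → SignType, ∃ σ : Equiv.Perm (Fin 3),
    ∃ ε : SignType, ε ≠ 0 ∧ ∃ t : Fin 3 → SignType, (∀ i, ε * s (σ i) = t i) ∧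
      (t = ![0, 0, 0] ∨ t = ![1, 0, 0] ∨ t = ![1, 1, 0] ∨ t = ![1, -1, 0] ∨ t = ![1, 1, 1] ∨
        t = ![1, 1, -1]) := by
  have key : ∀ s : Fin 3 → SignType, ∃ σ : Equiv.Perm (Fin 3), ∃ ε : SignType, ε ≠ 0 ∧
      ∃ t ∈ [![0, 0, 0], ![1, 0, 0], ![1, 1, 0], ![1, -1, 0], ![1, 1, 1], ![1, 1, -1]],
        ∀ i, ε * s (σ i) = t i := by decide
  intro s
  obtain ⟨σ, ε, hε, t, ht, h⟩ := key s
  exact ⟨σ, ε, hε, t, h, by simpa using ht⟩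

/-- `n` vectors spanning a complement of `W` when `finrank W + n = finrank V`. -/
theorem exists_span_sup_eq_top {V : Type*} [AddCommGroup V] [Module ℝ V] [FiniteDimensional ℝ V]
    (W : Submodule ℝ V) {n : ℕ} (h : Module.finrank ℝ W + n = Module.finrank ℝ V) :
    ∃ u : Fin n → V, ∀ S : Submodule ℝ V, W ≤ S → (∀ i, u i ∈ S) → S = ⊤ := by
  obtain ⟨K, hK⟩ := W.exists_isCompl
  have hn : Module.finrank ℝ K = n := by
    have := Submodule.finrank_add_eq_of_isCompl hK
    omega
  let b := Module.finBasisOfFinrankEq ℝ K hn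
  refine ⟨fun i => b i, fun S hW hu => ?_⟩
  rw [eq_top_iff, ← hK.sup_eq_top]
  refine sup_le hW ?_
  have : (⊤ : Submodule ℝ K) ≤ S.comap K.subtype := by
    rw [← b.span_eq, Submodule.span_le]
    rintro _ ⟨i, rfl⟩
    exact hu i
  exact fun x hx => this (x := ⟨x, hx⟩) trivial

theorem mem_span_sup {V : Type*} [AddCommGroup V] [Module ℝ V] {S : Submodule ℝ V} {u v : V}
    (h : ∀ T : Submodule ℝ V, S ≤ T → u ∈ T → v ∈ T → T = ⊤) (x : V) :
    ∃ s t : ℝ, ∃ r ∈ S, x = s • u + t • v + r := by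
  have hx : x ∈ Submodule.span ℝ {u, v} ⊔ S := by
    rw [h (Submodule.span ℝ {u, v} ⊔ S) le_sup_right
      (Submodule.mem_sup_left (Submodule.subset_span (by simp)))
      (Submodule.mem_sup_left (Submodule.subset_span (by simp)))]
    trivial
  obtain ⟨y, hy, r, hr, rfl⟩ := Submodule.mem_sup.1 hx
  obtain ⟨s, t, rfl⟩ := Submodule.mem_span_pair.1 hy
  exact ⟨s, t, r, hr, rfl⟩

/-! ### Classification by the dimensions of the lower central series. -/

section Classification

variable {A : Type*} [NonUnitalNonAssocCommRing A] [Module ℝ A]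
    [IsScalarTower ℝ A A] [SMulCommClass ℝ A A]

theorem lowerCentralSeries_succ_le_self (m : ℕ) :
    lowerCentralSeries A (m + 1) ≤ lowerCentralSeries A m := by
  induction m with
  | zero => exact le_top
  | succ m ih =>
    exact lowerCentralSeries_succ_le.2 fun x hx y => mul_mem_lowerCentralSeries (ih hx) y

/-- Each term determines the next, so two equal consecutive terms would make the series constant
from there on and keep it from reaching zero. -/
theorem finrank_lowerCentralSeries_succ_lt [FiniteDimensional ℝ A] (h : IsNilpotentAlgebra A)
    {m : ℕ} (hm : lowerCentralSeries A m ≠ ⊥) :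
    Module.finrank ℝ (lowerCentralSeries A (m + 1)) <
      Module.finrank ℝ (lowerCentralSeries A m) := by
  refine Submodule.finrank_lt_finrank_of_lt
    (lt_of_le_of_ne (lowerCentralSeries_succ_le_self m) fun heq => hm ?_)
  have key (k : ℕ) : lowerCentralSeries A (m + k) = lowerCentralSeries A m := by
    induction k with
    | zero => rfl
    | succ k ih => rw [← heq, ← add_assoc, lowerCentralSeries, ih, lowerCentralSeries]
  obtain ⟨n, hn⟩ := h
  rw [eq_bot_iff, ← hn]
  rcases le_total n m with hnm | hnm
  · obtain ⟨k, rfl⟩ := Nat.exists_eq_add_of_le hnm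
    exact (antitone_nat_of_succ_le lowerCentralSeries_succ_le_self) hnm
  · obtain ⟨k, rfl⟩ := Nat.exists_eq_add_of_le hnm
    rw [key]

theorem mul_eq_zero_of_mem {m : ℕ} (h : lowerCentralSeries A (m + 1) = ⊥) {x : A}
    (hx : x ∈ lowerCentralSeries A m) (y : A) : x * y = 0 := by
  have := mul_mem_lowerCentralSeries hx y
  rwa [h] at this

theorem mul_mem_lowerCentralSeries_one (x y : A) : x * y ∈ lowerCentralSeries A 1 :=
  mul_mem_lowerCentralSeries (m := 0) trivial y

/-- Modulo `A³`, the products of generators span `A²`. -/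
theorem lowerCentralSeries_one_le {u v : A}
    (h : ∀ T : Submodule ℝ A, lowerCentralSeries A 1 ≤ T → u ∈ T → v ∈ T → T = ⊤)
    {S : Submodule ℝ A} (hS : lowerCentralSeries A 2 ≤ S) (huu : u * u ∈ S) (huv : u * v ∈ S)
    (hvv : v * v ∈ S) : lowerCentralSeries A 1 ≤ S := by
  refine lowerCentralSeries_succ_le.2 fun x _ y => ?_
  obtain ⟨s, t, r, hr, rfl⟩ := mem_span_sup h x
  obtain ⟨s', t', r', hr', rfl⟩ := mem_span_sup h y
  have e : (s • u + t • v + r) * (s' • u + t' • v + r') = (s * s') • (u * u) +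
      (s * t' + t * s') • (u * v) + (t * t') • (v * v) +
      (r * (s' • u + t' • v + r') + r' * (s • u + t • v)) := by
    simp only [mul_add, add_mul, smul_mul_assoc, mul_smul_comm, mul_comm v u, mul_comm r' u,
      mul_comm r' v]
    module
  rw [e]
  exact S.add_mem (S.add_mem (S.add_mem (S.smul_mem _ huu) (S.smul_mem _ huv)) (S.smul_mem _ hvv))
    (S.add_mem (hS (mul_mem_lowerCentralSeries hr _)) (hS (mul_mem_lowerCentralSeries hr' _)))

theorem algIso_j1_of_mul_eq_zero (hA : Module.finrank ℝ A = 4) (h : ∀ x y : A, x * y = 0) :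
    AlgIso A (J4 .j1) := by
  have : FiniteDimensional ℝ A := Module.finite_of_finrank_eq_succ hA
  refine algIso_tableAlgebra_of_span _ hA (Module.finBasisOfFinrankEq ℝ A hA) (fun S hS => ?_)
    fun i j _ => by simp [h, table]
  rw [eq_top_iff, ← (Module.finBasisOfFinrankEq ℝ A hA).span_eq, Submodule.span_le]
  rintro _ ⟨i, rfl⟩
  exact hS i

theorem exists_algIso_of_diagonal (hA : Module.finrank ℝ A = 4) {w : A} {v : Fin 3 → A}
    (hspan : ∀ S : Submodule ℝ A, w ∈ S → (∀ i, v i ∈ S) → S = ⊤) (hw : ∀ x, w * x = 0)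
    (hv : ∀ i j, i ≠ j → v i * v j = 0) {t : Fin 3 → SignType}
    (ht : ∀ i, v i * v i = (t i : ℝ) • w)
    (h : t = ![0, 0, 0] ∨ t = ![1, 0, 0] ∨ t = ![1, 1, 0] ∨ t = ![1, -1, 0] ∨ t = ![1, 1, 1] ∨
        t = ![1, 1, -1]) : ∃ l, AlgIso A (J4 l) := by
  have hw' (x : A) : x * w = 0 := (mul_comm x w).trans (hw x)
  have h01 := hv 0 1 (by decide)
  have h02 := hv 0 2 (by decide)
  have h12 := hv 1 2 (by decide)
  have h0 := ht 0
  have h1 := ht 1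
  have h2 := ht 2
  have hs (S : Submodule ℝ A) (hwS : w ∈ S) (h0 : v 0 ∈ S) (h1 : v 1 ∈ S) (h2 : v 2 ∈ S) :
      S = ⊤ := hspan S hwS fun i => by fin_cases i <;> assumption
  clear hspan hv ht
  rcases h with rfl | rfl | rfl | rfl | rfl | rfl
  · refine ⟨.j1, algIso_J4_of_span _ hA (a := w) (b := v 0) (c := v 1) (d := v 2) hs
      ?_ ?_ ?_ ?_ ?_ ?_ ?_ ?_ ?_ ?_⟩
    all_goals simp_all [comb, table]
  · refine ⟨.j2, algIso_J4_of_span _ hA (a := v 0) (b := w) (c := v 1) (d := v 2)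
      (fun S h0 hw h1 h2 => hs S hw h0 h1 h2) ?_ ?_ ?_ ?_ ?_ ?_ ?_ ?_ ?_ ?_⟩
    all_goals simp_all [comb, table, e]
  · refine ⟨.j3 1, algIso_J4_of_span _ hA (a := v 0) (b := v 1) (c := w) (d := v 2)
      (fun S h0 h1 hw h2 => hs S hw h0 h1 h2) ?_ ?_ ?_ ?_ ?_ ?_ ?_ ?_ ?_ ?_⟩
    all_goals simp_all [comb, table, e]
  · refine ⟨.j3 (-1), algIso_J4_of_span _ hA (a := v 0) (b := v 1) (c := w) (d := v 2)
      (fun S h0 h1 hw h2 => hs S hw h0 h1 h2) ?_ ?_ ?_ ?_ ?_ ?_ ?_ ?_ ?_ ?_⟩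
    all_goals simp_all [comb, table, e]
  · refine ⟨.j5 1, algIso_J4_of_span _ hA (a := v 0) (b := v 1) (c := v 2) (d := w)
      (fun S h0 h1 h2 hw => hs S hw h0 h1 h2) ?_ ?_ ?_ ?_ ?_ ?_ ?_ ?_ ?_ ?_⟩
    all_goals simp_all [comb, table, e]
  · refine ⟨.j5 (-1), algIso_J4_of_span _ hA (a := v 0) (b := v 1) (c := v 2) (d := w)
      (fun S h0 h1 h2 hw => hs S hw h0 h1 h2) ?_ ?_ ?_ ?_ ?_ ?_ ?_ ?_ ?_ ?_⟩
    all_goals simp_all [comb, table, e]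

theorem exists_algIso_of_finrank_one (hA : Module.finrank ℝ A = 4)
    (h1 : Module.finrank ℝ (lowerCentralSeries A 1) = 1) (h2 : lowerCentralSeries A 2 = ⊥) :
    ∃ l, AlgIso A (J4 l) := by
  have : FiniteDimensional ℝ A := Module.finite_of_finrank_eq_succ hA
  obtain ⟨⟨w, hwmem⟩, hw0, hw⟩ := finrank_eq_one_iff'.1 h1
  have hw0 : w ≠ 0 := fun h => hw0 (Subtype.ext h)
  have hmul (x y : A) : ∃ t : ℝ, x * y = t • w := by
    obtain ⟨t, ht⟩ := hw ⟨x * y, mul_mem_lowerCentralSeries_one x y⟩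
    exact ⟨t, congrArg Subtype.val ht.symm⟩
  -- A functional nonzero at `w` turns the line-valued product into a scalar form without losing
  -- information.
  obtain ⟨φ, hφ⟩ : ∃ φ : Module.Dual ℝ A, φ w ≠ 0 := by
    by_contra! h
    exact hw0 ((Module.forall_dual_apply_eq_zero_iff ℝ w).1 h)
  have hφ' {x y : A} (h : φ (x * y) = 0) : x * y = 0 := by
    obtain ⟨t, ht⟩ := hmul x y
    rw [ht, map_smul, smul_eq_mul, mul_eq_zero, or_iff_left hφ] at h
    rw [ht, h, zero_smul]
  obtain ⟨K, hK⟩ := (lowerCentralSeries A 1).exists_isCompl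
  have hK3 : Module.finrank ℝ K = 3 := by
    have := Submodule.finrank_add_eq_of_isCompl hK
    omega
  let B : LinearMap.BilinForm ℝ K := ((LinearMap.mul ℝ A).compr₂ φ).domRestrict₁₂ K K
  have hB (x y : K) : B x y = φ (x * y : A) := rfl
  have : Invertible (2 : ℝ) := invertibleOfNonzero two_ne_zero
  obtain ⟨b, hb⟩ := LinearMap.BilinForm.exists_orthogonal_basis (B := B)
    ⟨fun x y => by simp [hB, mul_comm]⟩
  let v : Fin 3 → A := fun i => b (Fin.cast hK3.symm i)
  have hv (i j : Fin 3) (hij : i ≠ j) : v i * v j = 0 := hφ' (hb (by simpa [Fin.ext_iff] using hij))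
  have hspan (S : Submodule ℝ A) (hwS : w ∈ S) (hvS : ∀ i, v i ∈ S) : S = ⊤ := by
    rw [eq_top_iff, ← hK.sup_eq_top]
    refine sup_le (fun x hx => ?_) fun x hx => ?_
    · obtain ⟨t, ht⟩ := hw ⟨x, hx⟩
      have ht : t • w = x := congrArg Subtype.val ht
      exact ht ▸ S.smul_mem t hwS
    · have : (⊤ : Submodule ℝ K) ≤ S.comap K.subtype := by
        rw [← b.span_eq, Submodule.span_le]
        rintro _ ⟨i, rfl⟩
        exact hvS (Fin.cast hK3 i)
      exact this (x := ⟨x, hx⟩) trivial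
  choose r hr using fun i => hmul (v i) (v i)
  choose c hc0 hc using fun i => exists_sq_mul_eq_sign (r i)
  obtain ⟨σ, ε, hε, t, ht, h⟩ := exists_perm_sign_normal_form fun i => SignType.sign (r i)
  have hε0 : (ε : ℝ) ≠ 0 := by
    cases ε <;> simp at hε ⊢
  have hε1 : (ε : ℝ) * ε = 1 := by
    cases ε <;> simp at hε ⊢
  refine exists_algIso_of_diagonal hA (w := (ε : ℝ) • w) (v := fun i => c (σ i) • v (σ i))
    (fun S hwS hvS => hspan S ((S.smul_mem_iff hε0).1 hwS) fun i => ?_) (fun x => ?_)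
    (fun i j hij => ?_) (fun i => ?_) h
  · have := hvS (σ.symm i)
    rw [σ.apply_symm_apply] at this
    exact (S.smul_mem_iff (hc0 i)).1 this
  · rw [smul_mul_assoc, mul_eq_zero_of_mem h2 hwmem, smul_zero]
  · rw [smul_mul_smul_comm, hv _ _ (σ.injective.ne hij), smul_zero]
  · have ht' : (t i : ℝ) = ε * (SignType.sign (r (σ i)) : ℝ) := by
      rw [← ht i, SignType.coe_mul]
    rw [smul_mul_smul_comm, hr, ht', ← hc, smul_smul, smul_smul]
    congr 1
    linear_combination (-(c (σ i)) ^ 2 * r (σ i)) * hε1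

/-- The relation makes v² and vu span A²; rescaling `u` then normalises `s` to its sign. -/
theorem exists_algIso_of_sq_eq (hA : Module.finrank ℝ A = 4)
    (h2 : lowerCentralSeries A 2 = ⊥) {u v : A}
    (h : ∀ T : Submodule ℝ A, lowerCentralSeries A 1 ≤ T → u ∈ T → v ∈ T → T = ⊤)
    {s : ℝ} (hs : u * u = s • (v * v)) : ∃ l, AlgIso A (J4 l) := by
  have zero (x y z : A) : x * y * z = 0 :=
    mul_eq_zero_of_mem h2 (mul_mem_lowerCentralSeries_one x y) z
  have zero' (x y z : A) : z * (x * y) = 0 := (mul_comm _ _).trans (zero x y z)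
  have hspan (S : Submodule ℝ A) (hv : v ∈ S) (hu : u ∈ S) (hvv : v * v ∈ S) (hvu : v * u ∈ S) :
      S = ⊤ := by
    refine h S (lowerCentralSeries_one_le h (h2 ▸ bot_le) (hs ▸ S.smul_mem s hvv) ?_ hvv) hu hv
    rwa [mul_comm]
  by_cases hs0 : s = 0
  · subst hs0
    rw [zero_smul] at hs
    refine ⟨.j12, algIso_J4_of_span _ hA hspan ?_ ?_ ?_ ?_ ?_ ?_ ?_ ?_ ?_ ?_⟩
    all_goals simp [comb, table, e, hs, zero, zero']
  · obtain ⟨c, hc0, hc⟩ := exists_sq_mul_eq_sign s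
    have hspan' (S : Submodule ℝ A) (hv : v ∈ S) (hu : c • u ∈ S) (hvv : v * v ∈ S)
        (hvu : c • (v * u) ∈ S) : S = ⊤ :=
      hspan S hv ((S.smul_mem_iff hc0).1 hu) hvv ((S.smul_mem_iff hc0).1 hvu)
    have hcu : (c • u) * (c • u) = (SignType.sign s : ℝ) • (v * v) := by
      rw [smul_mul_smul_comm, hs, smul_smul, ← hc, pow_two]
    rcases lt_or_gt_of_ne hs0 with h0 | h0
    · rw [sign_neg h0] at hcu
      refine ⟨.j13 (-1), algIso_J4_of_span _ hA hspan' ?_ ?_ ?_ ?_ ?_ ?_ ?_ ?_ ?_ ?_⟩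
      all_goals try rw [hcu]
      all_goals simp [comb, table, e, zero, zero', mul_smul_comm]
    · rw [sign_pos h0] at hcu
      refine ⟨.j13 1, algIso_J4_of_span _ hA hspan' ?_ ?_ ?_ ?_ ?_ ?_ ?_ ?_ ?_ ?_⟩
      all_goals try rw [hcu]
      all_goals simp [comb, table, e, zero, zero', mul_smul_comm]

/-- Two generators modulo `A²` when `A²` has codimension two. -/
theorem exists_generators (hA : Module.finrank ℝ A = 4)
    (h1 : Module.finrank ℝ (lowerCentralSeries A 1) = 2) :
    ∃ u v : A, ∀ T : Submodule ℝ A, lowerCentralSeries A 1 ≤ T → u ∈ T → v ∈ T → T = ⊤ := by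
  have : FiniteDimensional ℝ A := Module.finite_of_finrank_eq_succ hA
  obtain ⟨u, hu⟩ := exists_span_sup_eq_top (lowerCentralSeries A 1) (n := 2) (by omega)
  exact ⟨u 0, u 1, fun T hT h0 h1 => hu T hT fun i => by fin_cases i <;> assumption⟩

theorem exists_algIso_of_finrank_two_of_eq_bot (hA : Module.finrank ℝ A = 4)
    (h1 : Module.finrank ℝ (lowerCentralSeries A 1) = 2) (h2 : lowerCentralSeries A 2 = ⊥) :
    ∃ l, AlgIso A (J4 l) := by
  have : FiniteDimensional ℝ A := Module.finite_of_finrank_eq_succ hA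
  obtain ⟨u, v, h⟩ := exists_generators hA h1
  let f : Fin 3 → lowerCentralSeries A 1 := ![⟨u * u, mul_mem_lowerCentralSeries_one u u⟩,
    ⟨u * v, mul_mem_lowerCentralSeries_one u v⟩, ⟨v * v, mul_mem_lowerCentralSeries_one v v⟩]
  -- Three products in a plane must satisfy a linear relation.
  have hf : ¬ LinearIndependent ℝ f := fun hf => by
    have := hf.fintype_card_le_finrank
    simp [h1] at this
  obtain ⟨g, hg, i, hi⟩ := Fintype.not_linearIndependent_iff.1 hf
  have hg : g 0 • (u * u) + g 1 • (u * v) + g 2 • (v * v) = 0 := by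
    simpa [f, Fin.sum_univ_three] using congrArg Subtype.val hg
  have key {u v : A}
      (h : ∀ T : Submodule ℝ A, lowerCentralSeries A 1 ≤ T → u ∈ T → v ∈ T → T = ⊤)
      {p q r : ℝ} (hp : p ≠ 0) (hg : p • (u * u) + q • (u * v) + r • (v * v) = 0) :
      ∃ l, AlgIso A (J4 l) := by
    have huu : u * u = (-(q / p)) • (u * v) + (-(r / p)) • (v * v) := by
      have : u * u = p⁻¹ • (p • (u * u) + q • (u * v) + r • (v * v)) + (-(q / p)) • (u * v) +
          (-(r / p)) • (v * v) := by
        match_scalars <;> field_simp <;> ring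
      rwa [hg, smul_zero, zero_add] at this
    -- Completing the square removes the mixed term; `s` is the resulting discriminant divided by
    -- 4p².
    refine exists_algIso_of_sq_eq hA h2 (u := u + (q / (2 * p)) • v) (v := v)
      (s := (q / (2 * p)) ^ 2 - r / p) (fun T hT hu hv => h T hT ?_ hv) ?_
    · simpa using T.sub_mem hu (T.smul_mem (q / (2 * p)) hv)
    · simp only [add_mul, mul_add, smul_mul_assoc, mul_smul_comm, mul_comm v u, huu]
      match_scalars <;> field_simp <;> ring
  by_cases h0 : g 0 = 0
  · by_cases h2' : g 2 = 0
    · have h1' : g 1 ≠ 0 := by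
        intro h1'
        fin_cases i <;> simp_all
      have huv : u * v = 0 := by
        simpa [h0, h2', h1'] using hg
      -- When the relation is just uv = 0, the elements u + v and u - v have equal squares.
      refine key (u := u + v) (v := u - v) (p := 1) (q := 0) (r := -1)
        (fun T hT hu hv => ?_) one_ne_zero ?_
      · have hu' : u ∈ T := by
          rw [show u = (1 / 2 : ℝ) • ((u + v) + (u - v)) by module]
          exact T.smul_mem _ (T.add_mem hu hv)
        exact h T hT hu' ((T.add_mem_iff_right hu').1 hu)
      · simp only [add_mul, mul_add, sub_mul, mul_sub, mul_comm v u, huv]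
        module
    · refine key (u := v) (v := u) (p := g 2) (q := g 1) (r := g 0)
        (fun T hT hv hu => h T hT hu hv) h2' ?_
      rw [mul_comm v u, ← hg]
      abel
  · exact key h h0 hg

theorem exists_algIso_of_finrank_three (hA : Module.finrank ℝ A = 4) [IsCommJordan A]
    (h1 : Module.finrank ℝ (lowerCentralSeries A 1) = 3) (h4 : lowerCentralSeries A 4 = ⊥) :
    ∃ l, AlgIso A (J4 l) := by
  have : FiniteDimensional ℝ A := Module.finite_of_finrank_eq_succ hA
  have jordan := IsCommJordan.lmul_comm_rmul_rmul (A := A)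
  have zero {x : A} (hx : x ∈ lowerCentralSeries A 3) (y : A) : x * y = 0 :=
    mul_eq_zero_of_mem h4 hx y
  have zero' {x : A} (hx : x ∈ lowerCentralSeries A 3) (y : A) : y * x = 0 :=
    (mul_comm _ _).trans (zero hx y)
  obtain ⟨u, hu⟩ := exists_span_sup_eq_top (lowerCentralSeries A 1) (n := 1) (by omega)
  obtain ⟨a, ha⟩ : ∃ a, u 0 = a := ⟨_, rfl⟩
  have h (T : Submodule ℝ A) (hT : lowerCentralSeries A 1 ≤ T) (haT : a ∈ T) : T = ⊤ :=
    hu T hT fun i => by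
      rw [Subsingleton.elim i 0, ha]
      exact haT
  obtain ⟨b, hb⟩ : ∃ b, a * a = b := ⟨_, rfl⟩
  obtain ⟨c, hc⟩ : ∃ c, a * b = c := ⟨_, rfl⟩
  obtain ⟨d, hd⟩ : ∃ d, a * c = d := ⟨_, rfl⟩
  have hb1 : b ∈ lowerCentralSeries A 1 := hb ▸ mul_mem_lowerCentralSeries_one a a
  have hc2 : c ∈ lowerCentralSeries A 2 := by
    rw [← hc, mul_comm]
    exact mul_mem_lowerCentralSeries hb1 a
  have hd3 : d ∈ lowerCentralSeries A 3 := by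
    rw [← hd, mul_comm]
    exact mul_mem_lowerCentralSeries hc2 a
  have hbb : b * b = d := by
    have := jordan a a
    rwa [hb, hc, hd] at this
  have hbc : b * c = 0 := by
    have := jordan a b
    rwa [hb, hc, hbb, zero' hd3, mul_comm] at this
  have hcc : c * c = 0 := by
    -- Expanding the Jordan identity at a + b leaves only 2 c² on one side and 0 on the other.
    have := jordan (a + b) b
    simp only [add_mul, mul_add, mul_comm b a, mul_comm c b, hb, hc, hbb, hbc, zero hd3,
      zero' hd3, add_zero, zero_add] at this
    have h2 : (2 : ℝ) • (c * c) = 0 := by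
      rw [two_smul]
      simpa using this
    exact (smul_eq_zero.1 h2).resolve_left two_ne_zero
  have L1 : lowerCentralSeries A 1 ≤ Submodule.span ℝ {b} ⊔ lowerCentralSeries A 2 := by
    -- A is generated by `a` alone, so 0 serves as the second generator.
    refine (lowerCentralSeries_one_le (u := a) (v := 0) (fun T hT haT _ => h T hT haT)
      le_sup_right ?_ ?_ ?_)
    · rw [hb]
      exact Submodule.mem_sup_left (Submodule.mem_span_singleton_self b)
    · simp
    · simp
  have decomp (x : A) : ∃ s : ℝ, ∃ r ∈ lowerCentralSeries A 1, x = s • a + r := by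
    obtain ⟨s, t, r, hr, rfl⟩ := mem_span_sup (S := lowerCentralSeries A 1) (u := a) (v := 0)
      (fun T hT haT _ => h T hT haT) x
    exact ⟨s, r, hr, by simp⟩
  have decomp1 {x : A} (hx : x ∈ lowerCentralSeries A 1) :
      ∃ s : ℝ, ∃ r ∈ lowerCentralSeries A 2, x = s • b + r := by
    obtain ⟨y, hy, r, hr, rfl⟩ := Submodule.mem_sup.1 (L1 hx)
    obtain ⟨s, rfl⟩ := Submodule.mem_span_singleton.1 hy
    exact ⟨s, r, hr, rfl⟩
  have L2 : lowerCentralSeries A 2 ≤ Submodule.span ℝ {c} ⊔ lowerCentralSeries A 3 := by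
    refine lowerCentralSeries_succ_le.2 fun x hx y => ?_
    obtain ⟨s, r, hr, rfl⟩ := decomp1 hx
    obtain ⟨t, r', hr', rfl⟩ := decomp y
    obtain ⟨s', r'', hr'', rfl⟩ := decomp1 hr'
    have e : (s • b + r) * (t • a + (s' • b + r'')) = (s * t) • c + ((s * s') • d +
        s • (r'' * b) + r * (t • a + (s' • b + r''))) := by
      simp only [add_mul, mul_add, smul_mul_assoc, mul_smul_comm, mul_comm b a, hc, hbb,
        mul_comm b r'']
      module
    rw [e]
    refine Submodule.add_mem_sup
      (Submodule.smul_mem _ _ (Submodule.mem_span_singleton_self c)) ?_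
    exact Submodule.add_mem _ (Submodule.add_mem _ (Submodule.smul_mem _ _ hd3)
      (Submodule.smul_mem _ _ (mul_mem_lowerCentralSeries hr'' _)))
      (mul_mem_lowerCentralSeries hr _)
  have decomp2 {x : A} (hx : x ∈ lowerCentralSeries A 2) :
      ∃ s : ℝ, ∃ r ∈ lowerCentralSeries A 3, x = s • c + r := by
    obtain ⟨y, hy, r, hr, rfl⟩ := Submodule.mem_sup.1 (L2 hx)
    obtain ⟨s, rfl⟩ := Submodule.mem_span_singleton.1 hy
    exact ⟨s, r, hr, rfl⟩
  have L3 : lowerCentralSeries A 3 ≤ Submodule.span ℝ {d} := by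
    refine lowerCentralSeries_succ_le.2 fun x hx y => ?_
    obtain ⟨s, r, hr, rfl⟩ := decomp2 hx
    obtain ⟨t, r', hr', rfl⟩ := decomp y
    obtain ⟨s', r'', hr'', rfl⟩ := decomp1 hr'
    obtain ⟨s'', r''', hr''', rfl⟩ := decomp2 hr''
    have e : (s • c + r) * (t • a + (s' • b + (s'' • c + r'''))) = (s * t) • d := by
      simp only [add_mul, mul_add, smul_mul_assoc, mul_smul_comm, mul_comm c a, mul_comm c b,
        hd, hbc, hcc, zero hr, zero' hr''']
      module
    rw [e]
    exact Submodule.smul_mem _ _ (Submodule.mem_span_singleton_self d)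
  refine ⟨.j11, algIso_J4_of_span _ hA (a := a) (b := b) (c := c) (d := d)
    (fun S haS hbS hcS hdS => ?_) ?_ ?_ ?_ ?_ ?_ ?_ ?_ ?_ ?_ ?_⟩
  · have l3 := L3.trans ((Submodule.span_singleton_le_iff_mem d S).2 hdS)
    have l2 := L2.trans (sup_le ((Submodule.span_singleton_le_iff_mem c S).2 hcS) l3)
    exact h S (L1.trans (sup_le ((Submodule.span_singleton_le_iff_mem b S).2 hbS) l2)) haS
  all_goals simp [comb, table, e, hb, hc, hd, hbb, hbc, hcc, zero' hd3]

theorem exists_algIso_of_finrank_two (hA : Module.finrank ℝ A = 4) [IsCommJordan A]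
    (h1 : Module.finrank ℝ (lowerCentralSeries A 1) = 2)
    (h2 : Module.finrank ℝ (lowerCentralSeries A 2) = 1) (h3 : lowerCentralSeries A 3 = ⊥) :
    ∃ l, AlgIso A (J4 l) := by
  have : FiniteDimensional ℝ A := Module.finite_of_finrank_eq_succ hA
  have zero {x : A} (hx : x ∈ lowerCentralSeries A 2) (y : A) : x * y = 0 :=
    mul_eq_zero_of_mem h3 hx y
  -- By polarisation, squares all lying in A³ would give A² ≤ A³.
  obtain ⟨x, hx⟩ : ∃ x : A, x * x ∉ lowerCentralSeries A 2 := by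
    by_contra! hsq
    have : lowerCentralSeries A 1 ≤ lowerCentralSeries A 2 := by
      refine lowerCentralSeries_succ_le.2 fun x _ y => ?_
      rw [show x * y = (1 / 2 : ℝ) • ((x + y) * (x + y) - x * x - y * y) by
        simp only [add_mul, mul_add, mul_comm y x]
        module]
      exact Submodule.smul_mem _ _ (Submodule.sub_mem _ (Submodule.sub_mem _ (hsq _) (hsq _))
        (hsq _))
    have := Submodule.finrank_mono this
    omega
  obtain ⟨c, hc⟩ : ∃ c, x * x = c := ⟨_, rfl⟩
  rw [hc] at hx
  have hc1 : c ∈ lowerCentralSeries A 1 := hc ▸ mul_mem_lowerCentralSeries_one x x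
  -- The Jordan identity rewrites x² x² as x(x x²), which lies in A⁴ = 0.
  have hcc : c * c = 0 := by
    have := IsCommJordan.lmul_comm_rmul_rmul x x
    rw [hc, mul_comm x (x * c), mul_comm x c] at this
    rw [this, zero (mul_mem_lowerCentralSeries hc1 x)]
  have L1 : lowerCentralSeries A 1 ≤ Submodule.span ℝ {c} ⊔ lowerCentralSeries A 2 := by
    have hle : Submodule.span ℝ {c} ⊔ lowerCentralSeries A 2 ≤ lowerCentralSeries A 1 :=
      sup_le ((Submodule.span_singleton_le_iff_mem _ _).2 hc1) (lowerCentralSeries_succ_le_self 1)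
    refine (Submodule.eq_of_le_of_finrank_le hle ?_).ge
    have : lowerCentralSeries A 2 < Submodule.span ℝ {c} ⊔ lowerCentralSeries A 2 :=
      lt_of_le_of_ne le_sup_right fun heq => hx (heq ▸
        Submodule.mem_sup_left (Submodule.mem_span_singleton_self c))
    have := Submodule.finrank_lt_finrank_of_lt this
    omega
  obtain ⟨u, v, h, hcu⟩ : ∃ u v : A, (∀ T : Submodule ℝ A, lowerCentralSeries A 1 ≤ T → u ∈ T →
      v ∈ T → T = ⊤) ∧ c * u ≠ 0 := by
    obtain ⟨u, v, h⟩ := exists_generators hA h1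
    by_cases hu : c * u = 0
    -- If c killed both generators it would kill A, and then A³ = 0.
    · refine ⟨v, u, fun T hT hv hu => h T hT hu hv, fun hv => ?_⟩
      have hc0 : c ∈ multiplier (⊥ : Submodule ℝ A) := fun y => by
        obtain ⟨s, t, r, hr, rfl⟩ := mem_span_sup h y
        obtain ⟨y, hy, r', hr', rfl⟩ := Submodule.mem_sup.1 (L1 hr)
        obtain ⟨s', rfl⟩ := Submodule.mem_span_singleton.1 hy
        simp [mul_add, mul_smul_comm, hu, hv, hcc, mul_comm c r', zero hr']
      have : lowerCentralSeries A 2 ≤ ⊥ := by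
        rw [lowerCentralSeries_succ_le_iff_multiplier]
        exact L1.trans (sup_le ((Submodule.span_singleton_le_iff_mem _ _).2 hc0)
          fun r hr y => zero hr y)
      rw [le_bot_iff.1 this, finrank_bot] at h2
      omega
    · exact ⟨u, v, h, hu⟩
  obtain ⟨d, hd⟩ : ∃ d, c * u = d := ⟨_, rfl⟩
  rw [hd] at hcu
  have hd2 : d ∈ lowerCentralSeries A 2 := hd ▸ mul_mem_lowerCentralSeries hc1 u
  have L2 {y : A} (hy : y ∈ lowerCentralSeries A 2) : ∃ t : ℝ, y = t • d := by
    obtain ⟨t, ht⟩ := (finrank_eq_one_iff_of_nonzero' (⟨d, hd2⟩ : lowerCentralSeries A 2)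
      (fun h => hcu (congrArg Subtype.val h))).1 h2 ⟨y, hy⟩
    exact ⟨t, congrArg Subtype.val ht.symm⟩
  have hmul (y z : A) : ∃ s t : ℝ, y * z = s • c + t • d := by
    obtain ⟨y', hy', r, hr, hyz⟩ := Submodule.mem_sup.1 (L1 (mul_mem_lowerCentralSeries_one y z))
    obtain ⟨s, rfl⟩ := Submodule.mem_span_singleton.1 hy'
    obtain ⟨t, rfl⟩ := L2 hr
    exact ⟨s, t, hyz.symm⟩
  -- Since cv = k d = k cu, the generator v - k u is killed by c.
  obtain ⟨k, hk⟩ := L2 (mul_mem_lowerCentralSeries hc1 v)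
  obtain ⟨b, hb⟩ : ∃ b, v - k • u = b := ⟨_, rfl⟩
  have hcb : c * b = 0 := by simp [← hb, mul_sub, mul_smul_comm, hk, hd]
  have h' (T : Submodule ℝ A) (hT : lowerCentralSeries A 1 ≤ T) (hu : u ∈ T) (hbT : b ∈ T) :
      T = ⊤ := by
    rw [← hb] at hbT
    exact h T hT hu (by simpa using T.add_mem hbT (T.smul_mem k hu))
  have l2 {S : Submodule ℝ A} (hdS : d ∈ S) : lowerCentralSeries A 2 ≤ S := fun y hy => by
    obtain ⟨t, rfl⟩ := L2 hy
    exact S.smul_mem t hdS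
  obtain ⟨p₁, p₂, hp⟩ := hmul u u
  obtain ⟨q₁, q₂, hq⟩ := hmul u b
  obtain ⟨r₁, r₂, hr⟩ := hmul b b
  have had : IsAdapted u b c d p₁ p₂ q₁ q₂ r₁ r₂ :=
    { span := fun S hu hb hc hd => h' S (L1.trans
        (sup_le ((Submodule.span_singleton_le_iff_mem _ _).2 hc) (l2 hd))) hu hb
      aa := hp
      ab := hq
      bb := hr
      ac := (mul_comm u c).trans hd
      bc := (mul_comm b c).trans hcb
      cc := hcc
      mul_d := fun x => (mul_comm x d).trans (zero hd2 x) }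
  refine had.exists_algIso hA ?_
  -- If the form vanished modulo d, all products of generators would lie in A³, forcing A² ≤ A³.
  by_contra! h0
  obtain ⟨rfl, rfl, rfl⟩ := h0
  have : lowerCentralSeries A 1 ≤ lowerCentralSeries A 2 := by
    refine lowerCentralSeries_one_le h' le_rfl ?_ ?_ ?_
    · simpa [hp] using Submodule.smul_mem _ _ hd2
    · simpa [hq] using Submodule.smul_mem _ _ hd2
    · simpa [hr] using Submodule.smul_mem _ _ hd2
  exact hx (this hc1)

theorem exists_algIso_J4 (hA : Module.finrank ℝ A = 4) [IsCommJordan A]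
    (h : IsNilpotentAlgebra A) : ∃ l, AlgIso A (J4 l) := by
  have : FiniteDimensional ℝ A := Module.finite_of_finrank_eq_succ hA
  have bot {m : ℕ} : lowerCentralSeries A m = ⊥ ↔
      Module.finrank ℝ (lowerCentralSeries A m) = 0 := Submodule.finrank_eq_zero.symm
  have step (m : ℕ) : Module.finrank ℝ (lowerCentralSeries A m) ≠ 0 →
      Module.finrank ℝ (lowerCentralSeries A (m + 1)) <
        Module.finrank ℝ (lowerCentralSeries A m) := fun hm =>
    finrank_lowerCentralSeries_succ_lt h (bot.not.2 hm)
  have mono (m : ℕ) : Module.finrank ℝ (lowerCentralSeries A (m + 1)) ≤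
      Module.finrank ℝ (lowerCentralSeries A m) :=
    Submodule.finrank_mono (lowerCentralSeries_succ_le_self m)
  have h0 : Module.finrank ℝ (lowerCentralSeries A 0) = 4 := by
    rw [lowerCentralSeries, finrank_top, hA]
  have s0 := step 0
  have s1 := step 1
  have s2 := step 2
  have s3 := step 3
  have m1 := mono 1
  have m2 := mono 2
  have m3 := mono 3
  simp only [Nat.reduceAdd] at s0 s1 s2 s3 m1 m2 m3
  obtain h1 | h1 | h1 | h1 : Module.finrank ℝ (lowerCentralSeries A 1) = 0 ∨
      Module.finrank ℝ (lowerCentralSeries A 1) = 1 ∨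
      Module.finrank ℝ (lowerCentralSeries A 1) = 2 ∨
      Module.finrank ℝ (lowerCentralSeries A 1) = 3 := by omega
  · exact ⟨_, algIso_j1_of_mul_eq_zero hA fun x y =>
      mul_eq_zero_of_mem (m := 0) (bot.2 h1) trivial y⟩
  · exact exists_algIso_of_finrank_one hA h1 (bot.2 (by omega))
  · obtain h2 | h2 : Module.finrank ℝ (lowerCentralSeries A 2) = 0 ∨
        Module.finrank ℝ (lowerCentralSeries A 2) = 1 := by omega
    · exact exists_algIso_of_finrank_two_of_eq_bot hA h1 (bot.2 h2)
    · exact exists_algIso_of_finrank_two hA h1 h2 (bot.2 (by omega))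
  · exact exists_algIso_of_finrank_three hA h1 (bot.2 (by omega))

end Classification

end RealNilpotentJordan

theorem mainTheorem2 :
    -- the list has 17 members
    Nat.card RealNilpotentJordan.Label = 17 ∧
    -- every member is a nilpotent Jordan algebra of dimension 4
    (∀ l : RealNilpotentJordan.Label,
      Module.finrank ℝ (RealNilpotentJordan.J4 l) = 4 ∧
      IsCommJordan (RealNilpotentJordan.J4 l) ∧
      RealNilpotentJordan.IsNilpotentAlgebra (RealNilpotentJordan.J4 l)) ∧
    -- the members are pairwise non-isomorphic
    (∀ l l' : RealNilpotentJordan.Label, l ≠ l' →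
      ¬ RealNilpotentJordan.AlgIso (RealNilpotentJordan.J4 l) (RealNilpotentJordan.J4 l')) ∧
    -- every nilpotent Jordan algebra of dimension 4 over ℝ is isomorphic to a member
    (∀ (A : Type u) [NonUnitalNonAssocCommRing A] [Module ℝ A] [IsScalarTower ℝ A A]
      [SMulCommClass ℝ A A] [IsCommJordan A],
      Module.finrank ℝ A = 4 → RealNilpotentJordan.IsNilpotentAlgebra A →
      ∃ l : RealNilpotentJordan.Label,
        RealNilpotentJordan.AlgIso A (RealNilpotentJordan.J4 l)) ∧
    -- which members have a central component, and how these split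
    (∀ l : RealNilpotentJordan.Label,
      RealNilpotentJordan.HasCentralComponent (RealNilpotentJordan.J4 l) ↔
        l ∈ RealNilpotentJordan.Label.withCentralComponent) ∧
    RealNilpotentJordan.AlgIso (RealNilpotentJordan.J4 .j1)
      (RealNilpotentJordan.J31 × RealNilpotentJordan.J11) ∧
    RealNilpotentJordan.AlgIso (RealNilpotentJordan.J4 .j2)
      (RealNilpotentJordan.J32 × RealNilpotentJordan.J11) ∧
    (∀ α : ℤˣ, RealNilpotentJordan.AlgIso (RealNilpotentJordan.J4 (.j3 α))
      (RealNilpotentJordan.J33 α × RealNilpotentJordan.J11)) ∧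
    RealNilpotentJordan.AlgIso (RealNilpotentJordan.J4 .j4)
      (RealNilpotentJordan.J34 × RealNilpotentJordan.J11) ∧
    -- which members are associative
    (∀ l : RealNilpotentJordan.Label,
      (∀ x y z : RealNilpotentJordan.J4 l, (x * y) * z = x * (y * z)) ↔
        l ∉ RealNilpotentJordan.Label.nonassociative) := by
  open RealNilpotentJordan in
  exact ⟨card_label, fun l => ⟨finrank_J4 l, isCommJordan_J4 l, isNilpotentAlgebra_J4 l⟩,
    not_algIso_J4, fun A _ _ _ _ _ hA h => exists_algIso_J4 hA h, hasCentralComponent_J4_iff,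
    algIso_j1, algIso_j2, algIso_j3, algIso_j4, associative_J4_iff⟩
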